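/- **Notation.** Let $A$ be a commutative ring (with $1$). For an ideal $\mathfrak q$ of $A$ and $n\ge 1$: - $\mathrm{SL}(n,A;\mathfrak q)=\{T\in \mathrm{SL}(n,A) : T\equiv I_n \bmod \mathfrak q\}$. - For $a\in A$ and $i\ne j$, $E_{i,j}(a)$ is the $n\times n$ matrix that differs from $I_n$ only in the $(i,j)$ entry, which is $a$. $E(n,A)$ is the subgroup of $\mathrm{SL}(n,A)$ generated by all the $E_{i,j}(a)$ with $a\in A$, $i\neq j$. $E^{\triangleleft}(n,A;\mathfrak q)$ is the subgroup generated by all $E(n,A)$-conjugates of the matrices $E_{i,j}(a)$ with $a\in\mathfrak q$, $i\ne j$. - $W(\mathfrak q)=\{(a,b)\in A\times A : a\equiv 1 \bmod \mathfrak q,\ b\in\mathfrak q,\ aA+bA=A\}$. **Conditions on $A$.** - For an integer $m\ge1$, $A$ satisfies $\mathrm{SR}_m$ if for all $r\ge m$ and all $a_0,\dots,a_r\in A$ with $a_0A+a_1A+\cdots+a_rA=A$ there are $a_1',\dots,a_r'\in A$ with $a_i'\equiv a_i \bmod a_0A$ for $1\le i\le r$ and $a_1'A+\cdots+a_r'A=A$.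 $A$ satisfies $\mathrm{SR}_{1\frac12}$ if $A/\mathfrak q$ satisfies $\mathrm{SR}_1$ for every nonzero ideal $\mathfrak q$ of $A$. - $A$ satisfies $\mathrm{GEN}(t,r)$ if for all $a,b\in A$ with $aA+bA=A$ there is $h\in a+bA$ such that $U/U^t$ can be generated by $r$ or fewer elements, where $U=(A/hA)^\times$. - $A$ satisfies $\mathrm{EXP}(t,\ell)$ if for every nonzero $q\in A$ and every $(a,b)\in W(qA)$ there are $a',c,d\in A$ and $u_i,f_i,g_i,b_i',d_i'\in A$ $(1\le i\le \ell)$ such that 1. $a'\equiv a \bmod bA$; 2. $\begin{pmatrix}a'&b\\c&d\end{pmatrix}\in \mathrm{SL}(2,A;qA)$; 3. $\begin{pmatrix}a'&b_i'\\c&d_i'\end{pmatrix}\in \mathrm{SL}(2,A;qA)$ for $1\le i\le\ell$; 4. $f_iI_2+g_i\begin{pmatrix}a'&b_i'\\c&d_i'\end{pmatrix}\in \mathrm{SL}(2,A;qA)$ for $1\le i\le\ell$; 5. $(f_1+g_1a')^2(f_2+g_2a')^2\cdots(f_\ell+g_\ell a')^2\equiv (a')^t \bmod cA$; 6. $u_i$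 is a unit of $A$ and $f_i+g_ia'\equiv u_i \bmod b_i'A$ for $1\le i\le\ell$. **Theorem.** Let $n\ge3$, let $t,r,\ell$ be positive integers, let $A$ be an integral domain satisfying $\mathrm{SR}_{1\frac12}$, $\mathrm{GEN}(t,r)$ and $\mathrm{EXP}(t,\ell)$, and let $\mathfrak q$ be an ideal of $A$. Then $E^{\triangleleft}(n,A;\mathfrak q)$ is a normal subgroup of $\mathrm{SL}(n,A;\mathfrak q)$, and the quotient group $\mathrm{SL}(n,A;\mathfrak q)/E^{\triangleleft}(n,A;\mathfrak q)$ is finite, of order at most $t^r$. -/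

import Mathlib

namespace BddGen

/-- Bass's stable range condition `SR_m`: every unimodular row `(a₀, a₁, …, a_r)` with `r ≥ m`
can be shortened to a unimodular row `(a₁', …, a_r')` with `a_i' ≡ a_i mod a₀ R`. -/
def StableRange (m : ℕ) (R : Type*) [CommRing R] : Prop :=
  ∀ r : ℕ, m ≤ r → ∀ (a₀ : R) (a : Fin r → R),
    Ideal.span (insert a₀ (Set.range a)) = ⊤ →
    ∃ a' : Fin r → R, (∀ i, a' i - a i ∈ Ideal.span {a₀}) ∧ Ideal.span (Set.range a') = ⊤

/-- The condition `SR_{1½}`: every quotient by a nonzero ideal satisfies `SR_1`. -/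
def StableRangeOneHalf (A : Type*) [CommRing A] : Prop :=
  ∀ q : Ideal A, q ≠ ⊥ → StableRange 1 (A ⧸ q)

/-- The subgroup `SL(n, A; q)` of the matrices in `SL(n, A)` congruent to the identity mod `q`. -/
def SLq (n : ℕ) {A : Type*} [CommRing A] (q : Ideal A) :
    Subgroup (Matrix.SpecialLinearGroup (Fin n) A) :=
  (Matrix.SpecialLinearGroup.map (Ideal.Quotient.mk q)).ker

theorem mem_SLq_iff {n : ℕ} {A : Type*} [CommRing A] {q : Ideal A}
    {T : Matrix.SpecialLinearGroup (Fin n) A} :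
    T ∈ SLq n q ↔ ∀ i j,
      (T : Matrix (Fin n) (Fin n) A) i j - (1 : Matrix (Fin n) (Fin n) A) i j ∈ q := by
  rw [SLq, MonoidHom.mem_ker, Matrix.SpecialLinearGroup.ext_iff]
  refine forall_congr' fun i => forall_congr' fun j => ?_
  rw [← Ideal.Quotient.eq]
  by_cases h : i = j <;> simp [Matrix.one_apply, h]

/-- The set `LU(n, q)` of the elementary matrices `E_{i,j}(a)` with `a ∈ q` and `i ≠ j`. -/
def LU (n : ℕ) {A : Type*} [CommRing A] (q : Ideal A) :
    Set (Matrix.SpecialLinearGroup (Fin n) A) :=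
  {T | ∃ (i j : Fin n) (hij : i ≠ j) (a : A),
    a ∈ q ∧ T = Matrix.SpecialLinearGroup.transvection hij a}

/-- The group `E(n, q)` generated by `LU(n, q)`; in particular `E(n, A)` is `Elem n ⊤`. -/
def Elem (n : ℕ) {A : Type*} [CommRing A] (q : Ideal A) :
    Subgroup (Matrix.SpecialLinearGroup (Fin n) A) :=
  Subgroup.closure (LU n q)

/-- The set of the `E(n, A)`-conjugates of elements of `LU(n, q)`. -/
def LUNormal (n : ℕ) {A : Type*} [CommRing A] (q : Ideal A) :
    Set (Matrix.SpecialLinearGroup (Fin n) A) :=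
  {T | ∃ g ∈ Elem n (⊤ : Ideal A), ∃ e ∈ LU n q, T = g * e * g⁻¹}

/-- The group `E^◁(n, A; q)` generated by the `E(n, A)`-conjugates of elements of `LU(n, q)`. -/
def ElemNormal (n : ℕ) {A : Type*} [CommRing A] (q : Ideal A) :
    Subgroup (Matrix.SpecialLinearGroup (Fin n) A) :=
  Subgroup.closure (LUNormal n q)

theorem ElemNormal_le_SLq (n : ℕ) {A : Type*} [CommRing A] (q : Ideal A) :
    ElemNormal n q ≤ SLq n q := by
  rw [ElemNormal, Subgroup.closure_le]
  rintro _ ⟨g, -, _, ⟨i, j, hij, a, ha, rfl⟩, rfl⟩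
  refine (MonoidHom.normal_ker (Matrix.SpecialLinearGroup.map (Ideal.Quotient.mk q))).conj_mem
    _ ?_ g
  change _ ∈ SLq n q
  rw [mem_SLq_iff]
  intro k l
  by_cases h : i = k ∧ j = l
  · simpa [Matrix.SpecialLinearGroup.transvection_coe, Matrix.single_apply, h] using ha
  · simp [Matrix.SpecialLinearGroup.transvection_coe, h]

/-- The set `W(q)` of the pairs `(a, b) ≡ (1, 0) mod q` with `aA + bA = A`. -/
def W {A : Type*} [CommRing A] (q : Ideal A) : Set (A × A) :=
  {p | p.1 - 1 ∈ q ∧ p.2 ∈ q ∧ Ideal.span {p.1, p.2} = ⊤}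

/-- The `2 × 2` matrix `M` is in `SL(2, A; q)`. -/
def InSL₂ {A : Type*} [CommRing A] (q : Ideal A) (M : Matrix (Fin 2) (Fin 2) A) : Prop :=
  ∃ T ∈ SLq 2 q, (T : Matrix (Fin 2) (Fin 2) A) = M

/-- The quotient group `U / U ^ t`, where `U` is the group of units of `R`. -/
abbrev UnitsModPow (t : ℕ) (R : Type*) [CommRing R] : Type _ :=
  Rˣ ⧸ (powMonoidHom t : Rˣ →* Rˣ).range

/-- The few generators property `GEN(t, r)`: if `aA + bA = A`, then there is `h ∈ a + bA` such that
the unit group of `A / hA` modulo `t`-th powers can be generated by `r` or fewer elements. -/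
def GEN (t r : ℕ) (A : Type*) [CommRing A] : Prop :=
  ∀ a b : A, Ideal.span {a, b} = ⊤ →
    ∃ h : A, h - a ∈ Ideal.span {b} ∧
      ∃ X : Finset (UnitsModPow t (A ⧸ Ideal.span {h})),
        X.card ≤ r ∧
          Subgroup.closure (X : Set (UnitsModPow t (A ⧸ Ideal.span {h}))) = ⊤

/-- The exponent property `EXP(t, ℓ)`. -/
def EXP (t l : ℕ) (A : Type*) [CommRing A] : Prop :=
  ∀ q : A, q ≠ 0 → ∀ a b : A, (a, b) ∈ W (Ideal.span {q}) →
    ∃ (a' c d : A) (u f g b' d' : Fin l → A),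
      a' - a ∈ Ideal.span {b} ∧
      InSL₂ (Ideal.span {q}) !![a', b; c, d] ∧
      (∀ i, InSL₂ (Ideal.span {q}) !![a', b' i; c, d' i]) ∧
      (∀ i, InSL₂ (Ideal.span {q})
        (f i • (1 : Matrix (Fin 2) (Fin 2) A) + g i • !![a', b' i; c, d' i])) ∧
      (∏ i, (f i + g i * a') ^ 2) - a' ^ t ∈ Ideal.span {c} ∧
      (∀ i, IsUnit (u i) ∧ f i + g i * a' - u i ∈ Ideal.span {b' i})

end BddGen

/-!
The quotient `SL(n, A; q) / E^◁(n, A; q)` is a group of Mennicke symbols, and the two arithmetic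
conditions on `A` bound the exponent and the number of generators of such a group.

*From matrices to symbols.* Over a domain with `SR_{1½}`, a unimodular row of length at least `3`
that is congruent to `(1, 0, …, 0)` mod `q` can be carried to `(1, 0, …, 0)` by `E^◁(n, A; q)`
(`IsRelUnimodular.rowEquiv_single`). Hence every element of `SL(n, A; q)` is a block `1 ⊕ g` with
`g ∈ SL(n - 1, A; q)`, up to factors in `E^◁(n, A; q)` (`exists_eq_mul_oneSum_mul`). Conjugating
elementary matrices by such blocks shows that `E^◁(n, A; q)` is normal in `SL(n, A)`
(`ElemNormal_normal`) and that the class of `1 ⊕ g` commutes with the classes of all elementary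
matrices (`commute_mk_oneSum`). By induction on `n` it remains to count cosets for `n = 3`
(`exists_coset_representatives`). There, every class comes from a matrix of `SL(2, A; q)` and depends
only on its first row `(a, b)`; it is a Mennicke symbol of `(a, b)`
(`isMennickeSymbol_mennickeSymbol`), as two identities between products of `3 × 3` matrices show.

*Bounding the symbols.* Fix a nonzero `q₀ ∈ q`; every symbol is the symbol of a pair in `W(q₀A)`
(`IsMennickeSymbol.exists_principal`). For fixed `a ≡ 1 mod q₀`, the symbol of `(a, q₀ y)` is a
homomorphism in `y ∈ (A / aA)ˣ` (`IsMennickeSymbol.scaled_mul`), and the symbols of the first row and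
the first column of a matrix of `SL(2, A; q₀A)` are inverse to each other
(`IsMennickeSymbol.row_mul_column`). With these rules `EXP(t, ℓ)` says that all symbols are killed by
`t` (`IsMennickeSymbol.pow_eq_one_of_EXP`). Finitely many symbols can be given a common first entry
`h`, which may be varied in a residue class (`IsMennickeSymbol.exists_common_left`), so `h` can be
chosen as in `GEN(t, r)`. The symbols in question then lie in the image of `U / U ^ t` for
`U = (A / hA)ˣ`, an abelian group of exponent dividing `t` with at most `r` generators, and so there
are at most `t ^ r` of them (`IsMennickeSymbol.card_le_of_GEN`).
-/

namespace BddGen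

/-! ### Mennicke symbols -/

/-- A Mennicke symbol on `W(q)` with values in a (not necessarily commutative) group `Q`, as a
function on all of `A × A` whose values outside `W(q)` are irrelevant: it is unchanged when a
`q`-multiple of `a` is added to `b` and when a multiple of `b` is added to `a`, and it is
multiplicative in each argument. -/
structure IsMennickeSymbol {A Q : Type*} [CommRing A] [Group Q] (q : Ideal A) (s : A → A → Q) :
    Prop where
  add_mul_right : ∀ a b t : A, a - 1 ∈ q → b ∈ q → IsCoprime a b → t ∈ q →
    s a (b + t * a) = s a b
  add_mul_left : ∀ a b t : A, a - 1 ∈ q → b ∈ q → IsCoprime a b → s (a + t * b) b = s a b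
  mul_right : ∀ a b₁ b₂ : A, a - 1 ∈ q → b₁ ∈ q → b₂ ∈ q → IsCoprime a b₁ → IsCoprime a b₂ →
    s a (b₁ * b₂) = s a b₁ * s a b₂
  mul_left : ∀ a₁ a₂ b : A, a₁ - 1 ∈ q → a₂ - 1 ∈ q → b ∈ q → IsCoprime a₁ b → IsCoprime a₂ b →
    s (a₁ * a₂) b = s a₁ b * s a₂ b

/-- The case of rows of length `2` is all that is needed of the condition `SR_{1½}`. -/
theorem StableRangeOneHalf.exists_isUnit_mod {A : Type*} [CommRing A]
    (hSR : StableRangeOneHalf A) {I : Ideal A} (hI : I ≠ ⊥) {x y : A}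
    (h : ∃ α β : A, α * x + β * y - 1 ∈ I) : ∃ t u : A, (x + t * y) * u - 1 ∈ I := by
  obtain ⟨α, β, hαβ⟩ := h
  have hspan : Ideal.span (insert (Ideal.Quotient.mk I y)
      (Set.range fun _ : Fin 1 => Ideal.Quotient.mk I x)) = ⊤ := by
    rw [Set.range_const, Ideal.eq_top_iff_one, Ideal.mem_span_pair]
    refine ⟨Ideal.Quotient.mk I β, Ideal.Quotient.mk I α, ?_⟩
    rw [← map_mul, ← map_mul, ← map_add, ← map_one (Ideal.Quotient.mk I), Ideal.Quotient.eq]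
    convert hαβ using 1
    ring
  obtain ⟨a', ha', htop⟩ := hSR I hI 1 le_rfl _ _ hspan
  obtain ⟨z, hz⟩ := Ideal.mem_span_singleton'.1 (ha' 0)
  obtain ⟨t, rfl⟩ := Ideal.Quotient.mk_surjective z
  rw [Set.range_unique, Ideal.span_singleton_eq_top] at htop
  obtain ⟨v, hv⟩ := htop.exists_right_inv
  obtain ⟨u, rfl⟩ := Ideal.Quotient.mk_surjective v
  refine ⟨t, u, ?_⟩
  rw [← Ideal.Quotient.eq, map_mul, map_add, map_mul, map_one, ← hv, hz]
  simp

theorem StableRangeOneHalf.exists_isCoprime {A : Type*} [CommRing A]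
    (hSR : StableRangeOneHalf A) {w : A} (hw : w ≠ 0) {x y : A} (h : IsCoprime x y) :
    ∃ t : A, IsCoprime (x + t * y) w := by
  obtain ⟨α, β, hαβ⟩ := h
  obtain ⟨t, u, htu⟩ := hSR.exists_isUnit_mod (I := Ideal.span {w})
    (by simpa [Ideal.span_singleton_eq_bot] using hw) (x := x) (y := y)
    ⟨α, β, by rw [hαβ, sub_self]; exact zero_mem _⟩
  obtain ⟨c, hc⟩ := Ideal.mem_span_singleton'.1 htu
  exact ⟨t, u, -c, by linear_combination -hc⟩

namespace IsMennickeSymbol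

variable {A Q : Type*} [CommRing A] [Group Q] {q : Ideal A} {s : A → A → Q}

theorem one_left (hs : IsMennickeSymbol q s) {b : A} (hb : b ∈ q) : s 1 b = 1 := by
  have h := hs.mul_left 1 1 b (by simp) (by simp) hb isCoprime_one_left isCoprime_one_left
  rw [mul_one] at h
  exact left_eq_mul.1 h

theorem unit_left (hs : IsMennickeSymbol q s) {u b : A} (hu : IsUnit u) (hu1 : u - 1 ∈ q)
    (hb : b ∈ q) : s u b = 1 := by
  obtain ⟨v, hv⟩ := hu.exists_right_inv
  have hcop : ∀ z, IsCoprime u z := fun z => ⟨v, 0, by linear_combination hv⟩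
  have ht : -(v * (u - 1)) - v * b ∈ q :=
    sub_mem (neg_mem (q.mul_mem_left _ hu1)) (q.mul_mem_left _ hb)
  have h1u : 1 - u ∈ q := by simpa using neg_mem hu1
  rw [← hs.add_mul_right u b _ hu1 hb (hcop _) ht,
    show b + (-(v * (u - 1)) - v * b) * u = 1 - u by linear_combination (1 - u - b) * hv,
    ← hs.add_mul_left u (1 - u) 1 hu1 h1u (hcop _), show u + 1 * (1 - u) = 1 by ring]
  exact hs.one_left h1u

section Principal

variable {q₀ : A}

theorem isCoprime_of_dvd_sub_one {a : A} (ha : q₀ ∣ a - 1) : IsCoprime a q₀ := by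
  obtain ⟨x, hx⟩ := ha
  exact ⟨1, -x, by linear_combination hx⟩

theorem eq_one_of_dvd (hs : IsMennickeSymbol q s) {a b : A} (hb : b ∈ q)
    (ha : b ∣ a - 1) : s a b = 1 := by
  obtain ⟨x, hx⟩ := ha
  rw [← hs.add_mul_left a b (-x) (by rw [hx]; exact q.mul_mem_right _ hb) hb
    (isCoprime_of_dvd_sub_one ⟨x, hx⟩), show a + -x * b = 1 by linear_combination hx]
  exact hs.one_left hb

theorem mod_left (hs : IsMennickeSymbol q s) {a a' b : A} (ha : a - 1 ∈ q) (hb : b ∈ q)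
    (hab : IsCoprime a b) (h : b ∣ a' - a) : s a' b = s a b := by
  obtain ⟨x, hx⟩ := h
  rw [← hs.add_mul_left a b x ha hb hab, show a' = a + x * b by linear_combination hx]

/-- For `a ≡ 1 mod q₀`, the symbol of `(a, q₀ y)` is multiplicative in `y`: the extra factor `q₀` is
harmless because the symbol of `(a, q₀)` is trivial. -/
theorem scaled_mul (hs : IsMennickeSymbol q s) (hq₀ : q₀ ∈ q) {a y₁ y₂ : A} (ha : q₀ ∣ a - 1)
    (h₁ : IsCoprime a y₁) (h₂ : IsCoprime a y₂) :
    s a (q₀ * (y₁ * y₂)) = s a (q₀ * y₁) * s a (q₀ * y₂) := by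
  have hc := isCoprime_of_dvd_sub_one ha
  have haq : a - 1 ∈ q := q.mem_of_dvd ha hq₀
  have hm : ∀ y, q₀ * y ∈ q := fun y => q.mul_mem_right _ hq₀
  have h := hs.mul_right a q₀ (q₀ * (y₁ * y₂)) haq hq₀ (hm _) hc
    (hc.mul_right (h₁.mul_right h₂))
  rw [hs.eq_one_of_dvd hq₀ ha, one_mul] at h
  rw [← h, ← hs.mul_right a (q₀ * y₁) (q₀ * y₂) haq (hm _) (hm _) (hc.mul_right h₁)
    (hc.mul_right h₂)]
  congr 1
  ring

theorem scaled_mod (hs : IsMennickeSymbol q s) (hq₀ : q₀ ∈ q) {a y y' : A} (ha : q₀ ∣ a - 1)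
    (hy : IsCoprime a y) (h : a ∣ y' - y) : s a (q₀ * y') = s a (q₀ * y) := by
  obtain ⟨x, hx⟩ := h
  rw [← hs.add_mul_right a (q₀ * y) (q₀ * x) (q.mem_of_dvd ha hq₀) (q.mul_mem_right _ hq₀)
    ((isCoprime_of_dvd_sub_one ha).mul_right hy) (q.mul_mem_right _ hq₀),
    show q₀ * y' = q₀ * y + q₀ * x * a by linear_combination q₀ * hx]

/-- The symbols of the first row and of the first column of a matrix in `SL(2, A; q₀A)` are inverse
to each other. -/
theorem row_mul_column (hs : IsMennickeSymbol q s) (hq₀ : q₀ ∈ q) {a β γ d : A} (ha : q₀ ∣ a - 1)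
    (hdet : a * d - q₀ * β * (q₀ * γ) = 1) : s a (q₀ * β) * s a (q₀ * γ) = 1 := by
  have hc := isCoprime_of_dvd_sub_one ha
  have hβ : IsCoprime a β := ⟨d, -(q₀ * (q₀ * γ)), by linear_combination hdet⟩
  have hγ : IsCoprime a γ := ⟨d, -(q₀ * (q₀ * β)), by linear_combination hdet⟩
  have h1 := hs.scaled_mul hq₀ ha hc (hβ.mul_right (hc.mul_right hγ))
  have hq1 : s a (q₀ * q₀) = 1 := by
    rw [hs.mul_right a q₀ q₀ (q.mem_of_dvd ha hq₀) hq₀ hq₀ hc hc,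
      hs.eq_one_of_dvd hq₀ ha, one_mul]
  have h2 := hs.scaled_mul hq₀ ha hβ (hc.mul_right hγ)
  have h3 := hs.scaled_mul hq₀ ha hc hγ
  rw [hq1, one_mul] at h1 h3
  rw [← h3, ← h2, ← h1, hs.scaled_mod hq₀ ha (y := -1) ⟨1, a - 1, by ring⟩
    ⟨d, by linear_combination -hdet⟩]
  exact hs.eq_one_of_dvd (q.mul_mem_right _ hq₀) (by simpa using ha)

end Principal

end IsMennickeSymbol

/-! ### The exponent of a group of Mennicke symbols -/

theorem InSL₂.entries {A : Type*} [CommRing A] {q₀ a b c d : A}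
    (h : InSL₂ (Ideal.span {q₀}) !![a, b; c, d]) :
    q₀ ∣ a - 1 ∧ q₀ ∣ b ∧ q₀ ∣ c ∧ q₀ ∣ d - 1 ∧ a * d - b * c = 1 := by
  obtain ⟨T, hT, hM⟩ := h
  have hdet : T.1.det = 1 := T.2
  have key := mem_SLq_iff.1 hT
  rw [hM] at key hdet
  rw [Matrix.det_fin_two_of] at hdet
  simp only [Ideal.mem_span_singleton] at key
  exact ⟨by simpa using key 0 0, by simpa using key 0 1, by simpa using key 1 0,
    by simpa using key 1 1, hdet⟩

namespace IsMennickeSymbol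

variable {A Q : Type*} [CommRing A] [Group Q] {q : Ideal A} {s : A → A → Q}

theorem pow_left (hs : IsMennickeSymbol q s) {a b : A} (ha : a - 1 ∈ q) (hb : b ∈ q)
    (hab : IsCoprime a b) (k : ℕ) : a ^ k - 1 ∈ q ∧ s (a ^ k) b = s a b ^ k := by
  induction k with
  | zero => simpa using hs.one_left hb
  | succ k ih =>
    refine ⟨?_, ?_⟩
    · rw [show a ^ (k + 1) - 1 = a * (a ^ k - 1) + (a - 1) by ring]
      exact add_mem (q.mul_mem_left _ ih.1) ha
    · rw [pow_succ, hs.mul_left _ _ _ ih.1 ha hb hab.pow_left hab, ih.2, pow_succ]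

theorem prod_left_eq_one (hs : IsMennickeSymbol q s) {ι : Type*} (S : Finset ι) {x : ι → A} {b : A}
    (hb : b ∈ q) (hx : ∀ i, x i - 1 ∈ q) (hxb : ∀ i, IsCoprime (x i) b)
    (h : ∀ i, s (x i) b = 1) : ∏ i ∈ S, x i - 1 ∈ q ∧ s (∏ i ∈ S, x i) b = 1 := by
  classical
  induction S using Finset.induction_on with
  | empty => simpa using hs.one_left hb
  | insert i S hi ih =>
    rw [Finset.prod_insert hi]
    refine ⟨?_, ?_⟩
    · rw [show x i * ∏ j ∈ S, x j - 1 = x i * (∏ j ∈ S, x j - 1) + (x i - 1) by ring]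
      exact add_mem (q.mul_mem_left _ ih.1) (hx i)
    · rw [hs.mul_left _ _ _ (hx i) ih.1 hb (hxb i) (IsCoprime.prod_left fun j _ => hxb j), h i,
        ih.2, one_mul]

/-- If `M = (a, b; c, d)` and `f + g M` both lie in `SL(2, A; q₀A)` and the entry `x = f + g a` is
congruent to a unit mod `b`, then the symbol of `(x, c)` is trivial. Indeed the symbols of
`(x, g b)` and `(x, g c)` are inverse to each other, that of `(x, b)` is trivial, and that of
`(x, q₀ g)` has square `1` because `det (f + g M) = 1` forces `x ^ 2 ≡ 1 mod q₀ g`. -/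
theorem eq_one_of_linear_combination (hs : IsMennickeSymbol q s) {q₀ : A} (hq₀ : q₀ ∈ q)
    {a b c d f g u : A} (hM : InSL₂ (Ideal.span {q₀}) !![a, b; c, d])
    (hN : InSL₂ (Ideal.span {q₀})
      (f • (1 : Matrix (Fin 2) (Fin 2) A) + g • !![a, b; c, d]))
    (hu : IsUnit u) (hxu : b ∣ f + g * a - u) :
    q₀ ∣ f + g * a - 1 ∧ IsCoprime (f + g * a) c ∧ s (f + g * a) c = 1 := by
  have hN' : f • (1 : Matrix (Fin 2) (Fin 2) A) + g • !![a, b; c, d]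
      = !![f + g * a, g * b; g * c, f + g * d] := by
    ext i j
    fin_cases i <;> fin_cases j <;> simp
  rw [hN'] at hN
  obtain ⟨⟨p, hp⟩, ⟨β, rfl⟩, ⟨γ, rfl⟩, ⟨p', hp'⟩, hdM⟩ := hM.entries
  obtain ⟨hx, -, -, -, hdN⟩ := hN.entries
  have hxsq : q₀ * g ∣ (f + g * a) ^ 2 - 1 := by
    refine ⟨-(f * (p + p')) + g * p * (q₀ * p) + 2 * p * (f + g), ?_⟩
    linear_combination hdN - g ^ 2 * hdM + (2 * g ^ 2 + g ^ 2 * (a - 1) + g ^ 2 * q₀ * p + f * g) * hp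
      - f * g * hp'
  have hxu' := hxu
  set x := f + g * a with hxdef
  clear_value x
  have hxq : x - 1 ∈ q := q.mem_of_dvd hx hq₀
  have hbq : q₀ * β ∈ q := q.mul_mem_right _ hq₀
  have hxg : IsCoprime x g := ⟨f + g * d, -(q₀ * β * (g * (q₀ * γ))), by linear_combination hdN⟩
  have hxβ : IsCoprime x β := ⟨f + g * d, -(g * q₀ * (g * (q₀ * γ))), by linear_combination hdN⟩
  have hxγ : IsCoprime x γ := ⟨f + g * d, -(g * q₀ * (g * (q₀ * β))), by linear_combination hdN⟩
  have hc := isCoprime_of_dvd_sub_one hx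
  have hb1 : s x (q₀ * β) = 1 := by
    have huq : u - 1 ∈ q := by
      rw [show u - 1 = (x - 1) - (x - u) by ring]
      exact sub_mem hxq (q.mem_of_dvd hxu hbq)
    obtain ⟨v, hv⟩ := hu.exists_left_inv
    rw [hs.mod_left huq hbq ⟨v, 0, by linear_combination hv⟩ hxu]
    exact hs.unit_left hu huq hbq
  have hg2 : s x (q₀ * g) * s x (q₀ * g) = 1 := by
    rw [← hs.mul_left x x _ hxq hxq (q.mul_mem_right _ hq₀) (hc.mul_right hxg) (hc.mul_right hxg),
      ← pow_two]
    exact hs.eq_one_of_dvd (q.mul_mem_right _ hq₀) hxsq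
  have key := hs.row_mul_column hq₀ (β := g * β) (γ := g * γ) (d := f + g * d) hx
    (by linear_combination hdN)
  rw [hs.scaled_mul hq₀ hx hxg hxβ, hs.scaled_mul hq₀ hx hxg hxγ, hb1, mul_one, ← mul_assoc, hg2,
    one_mul] at key
  exact ⟨hx, hc.mul_right hxγ, key⟩

theorem pow_eq_one_of_EXP (hs : IsMennickeSymbol q s) {t l : ℕ} (hEXP : EXP t l A) {q₀ : A}
    (hq₀ : q₀ ∈ q) (h0 : q₀ ≠ 0) {a b : A} (ha : q₀ ∣ a - 1) (hb : q₀ ∣ b)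
    (hab : IsCoprime a b) : s a b ^ t = 1 := by
  have hW : (a, b) ∈ W (Ideal.span {q₀}) := by
    obtain ⟨x, y, hxy⟩ := hab
    exact ⟨Ideal.mem_span_singleton.2 ha, Ideal.mem_span_singleton.2 hb,
      (Ideal.eq_top_iff_one _).2 (Ideal.mem_span_pair.2 ⟨x, y, hxy⟩)⟩
  obtain ⟨a', c, d, u, f, g, b', d', haa', hM, hMi, hNi, hprod, hu⟩ := hEXP q₀ h0 a b hW
  rw [Ideal.mem_span_singleton] at haa' hprod
  obtain ⟨ha', ⟨β, rfl⟩, ⟨γ, rfl⟩, -, hdet⟩ := hM.entries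
  have hq₀β : q₀ * β ∈ q := q.mul_mem_right _ hq₀
  have hcq : q₀ * γ ∈ q := q.mul_mem_right _ hq₀
  have ha'q : a' - 1 ∈ q := q.mem_of_dvd ha' hq₀
  have ha'c : IsCoprime a' (q₀ * γ) := ⟨d, -(q₀ * β), by linear_combination hdet⟩
  have hi := fun i => hs.eq_one_of_linear_combination hq₀ (hMi i) (hNi i) (hu i).1
    (Ideal.mem_span_singleton.1 (hu i).2)
  have hxq : ∀ i, f i + g i * a' - 1 ∈ q := fun i => q.mem_of_dvd (hi i).1 hq₀
  have hsq := fun i => hs.pow_left (hxq i) hcq (hi i).2.1 2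
  have hc1 : s a' (q₀ * γ) ^ t = 1 := by
    obtain ⟨hpq, hpow⟩ := hs.pow_left ha'q hcq ha'c t
    rw [← hpow, ← hs.mod_left hpq hcq ha'c.pow_left hprod]
    exact (hs.prod_left_eq_one Finset.univ hcq (fun i => (hsq i).1)
      (fun i => (hi i).2.1.pow_left) fun i => by rw [(hsq i).2, (hi i).2.2, one_pow]).2
  rw [← hs.mod_left (q.mem_of_dvd ha hq₀) hq₀β hab haa',
    eq_inv_of_mul_eq_one_left (hs.row_mul_column hq₀ ha' hdet), inv_pow, hc1, inv_one]

/-- If `A` satisfies `SR_{1½}`, then every symbol of `W(q)` is a symbol of `W(q₀A)`, for any nonzero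
`q₀ ∈ q`. -/
theorem exists_principal (hs : IsMennickeSymbol q s) (hSR : StableRangeOneHalf A) {q₀ : A}
    (hq₀ : q₀ ∈ q) (h0 : q₀ ≠ 0) {a b : A} (ha : a - 1 ∈ q) (hb : b ∈ q) (hab : IsCoprime a b) :
    ∃ a' y : A, q₀ ∣ a' - 1 ∧ IsCoprime a' y ∧ s a b = s a' (q₀ * y) := by
  obtain ⟨t, ht⟩ := hSR.exists_isCoprime h0 hab
  have e₁ := hs.add_mul_left a b t ha hb hab
  have ha₁ : a + t * b - 1 ∈ q := by
    rw [show a + t * b - 1 = (a - 1) + t * b by ring]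
    exact add_mem ha (q.mul_mem_left _ hb)
  have hab₁ : IsCoprime (a + t * b) b := by simpa using hab.add_mul_right_left t
  set a₁ := a + t * b
  obtain ⟨u, v, huv⟩ := ht
  -- `a₁` is a unit mod `q₀`, so a `q`-multiple of `a₁` can be added to `b` to get `1 - a₁` mod `q₀`;
  -- adding the result to `a₁` makes it `1` mod `q₀`.
  have hr : u * (1 - a₁ - b) ∈ q := q.mul_mem_left _ (sub_mem (by simpa using neg_mem ha₁) hb)
  have e₂ := hs.add_mul_right a₁ b _ ha₁ hb hab₁ hr
  have hb₂ : b + u * (1 - a₁ - b) * a₁ ∈ q := add_mem hb (q.mul_mem_right _ hr)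
  have hab₂ : IsCoprime a₁ (b + u * (1 - a₁ - b) * a₁) := hab₁.add_mul_right_right _
  have hb₂' : b + u * (1 - a₁ - b) * a₁ = 1 - a₁ - q₀ * (v * (1 - a₁ - b)) := by
    linear_combination (1 - a₁ - b) * huv
  set b₂ := b + u * (1 - a₁ - b) * a₁
  have e₃ := hs.add_mul_left a₁ b₂ 1 ha₁ hb₂ hab₂
  have hab₃ : IsCoprime (a₁ + 1 * b₂) b₂ := by simpa using hab₂.add_mul_right_left 1
  have ha₃ : q₀ ∣ a₁ + 1 * b₂ - 1 := ⟨-(v * (1 - a₁ - b)), by linear_combination hb₂'⟩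
  set a₃ := a₁ + 1 * b₂
  have e₄ := hs.add_mul_right a₃ b₂ (-b₂) (q.mem_of_dvd ha₃ hq₀) hb₂ hab₃ (neg_mem hb₂)
  have hab₄ : IsCoprime a₃ (b₂ + -b₂ * a₃) := hab₃.add_mul_right_right _
  obtain ⟨z, hz⟩ := ha₃
  have hb₄ : b₂ + -b₂ * a₃ = q₀ * (-(b₂ * z)) := by linear_combination -b₂ * hz
  rw [hb₄] at hab₄ e₄
  exact ⟨a₃, _, ⟨z, hz⟩, hab₄.of_mul_right_right, by rw [e₄, e₃, e₂, e₁]⟩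

end IsMennickeSymbol

/-! ### The order of a group of Mennicke symbols -/

theorem card_le_pow_of_closure_eq_top {G : Type*} [CommGroup G] {t r : ℕ} (ht : 0 < t)
    (hG : ∀ g : G, g ^ t = 1) (X : Finset G) (hX : X.card ≤ r)
    (htop : Subgroup.closure (X : Set G) = ⊤) : Finite G ∧ Nat.card G ≤ t ^ r := by
  have : Group.FG G := Group.fg_iff.2 ⟨X, htop, X.finite_toSet⟩
  have hdvd := card_dvd_exponent_pow_rank' G hG
  have hpos : 0 < t ^ Group.rank G := pow_pos ht _
  exact ⟨Nat.finite_of_card_ne_zero fun h => hpos.ne' (by simpa [h] using hdvd),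
    (Nat.le_of_dvd hpos hdvd).trans
      (Nat.pow_le_pow_right ht ((Group.rank_le htop).trans hX))⟩

theorem isCoprime_of_dvd_sub {A : Type*} [CommRing A] {a a' y : A} (h : IsCoprime a y)
    (hd : y ∣ a' - a) : IsCoprime a' y := by
  obtain ⟨z, hz⟩ := hd
  rw [show a' = a + y * z by linear_combination hz]
  exact h.add_mul_left_left z

theorem isCoprime_out_unit {A : Type*} [CommRing A] {h : A} (u : (A ⧸ Ideal.span {h})ˣ) :
    IsCoprime h (Quotient.out (u : A ⧸ Ideal.span {h})) := by
  have h1 : Ideal.Quotient.mk (Ideal.span {h}) (Quotient.out (u : A ⧸ Ideal.span {h})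
      * Quotient.out ((u⁻¹ : (A ⧸ Ideal.span {h})ˣ) : A ⧸ Ideal.span {h}))
      = Ideal.Quotient.mk (Ideal.span {h}) 1 := by
    rw [map_mul, Ideal.Quotient.mk_out, Ideal.Quotient.mk_out, map_one, Units.mul_inv]
  obtain ⟨c, hc⟩ := Ideal.mem_span_singleton'.1 (Ideal.Quotient.eq.1 h1)
  exact ⟨-c, Quotient.out ((u⁻¹ : (A ⧸ Ideal.span {h})ˣ) : A ⧸ Ideal.span {h}),
    by linear_combination -hc⟩

namespace IsMennickeSymbol

variable {A Q : Type*} [CommRing A] [Group Q] {q : Ideal A} {s : A → A → Q}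

/-- Finitely many symbols can be written with the same first entry, which may moreover be any
element of a suitable residue class. The second entries are made pairwise coprime by `SR_{1½}`, and
the common first entry is then found by the Chinese remainder theorem. -/
theorem exists_common_left [IsDomain A] (hs : IsMennickeSymbol q s) (hSR : StableRangeOneHalf A)
    {q₀ : A} (hq₀ : q₀ ∈ q) (h0 : q₀ ≠ 0) (S : Finset Q)
    (hS : ∀ x ∈ S, ∃ a b : A, a - 1 ∈ q ∧ b ∈ q ∧ IsCoprime a b ∧ s a b = x) :
    ∃ a w : A, w ≠ 0 ∧ q₀ ∣ a - 1 ∧ IsCoprime a w ∧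
      ∀ a' : A, q₀ * w ∣ a' - a → ∀ x ∈ S, ∃ y : A, IsCoprime a' y ∧ s a' (q₀ * y) = x := by
  classical
  induction S using Finset.induction_on with
  | empty => exact ⟨1, 1, one_ne_zero, by simp, isCoprime_one_left, by simp⟩
  | insert x S _ ih =>
    obtain ⟨a, w, hw, ha, haw, h⟩ := ih fun x hx => hS x (Finset.mem_insert_of_mem hx)
    obtain ⟨a₀, b₀, ha₀, hb₀, hab₀, rfl⟩ := hS x (Finset.mem_insert_self x S)
    obtain ⟨a₁, y₁, ha₁, hay₁, e₁⟩ := hs.exists_principal hSR hq₀ h0 ha₀ hb₀ hab₀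
    obtain ⟨k, hk0, hk⟩ : ∃ k : A, y₁ + k * a₁ ≠ 0 ∧ IsCoprime (y₁ + k * a₁) (q₀ * w) := by
      obtain ⟨k, hk⟩ := hSR.exists_isCoprime (mul_ne_zero h0 hw) hay₁.symm
      by_cases hz : y₁ + k * a₁ = 0
      · -- Here `a₁` is a unit, and `y₁ + (k + 1) * a₁ = a₁`.
        obtain ⟨m, m', hm⟩ := hay₁
        have hu : (m - m' * k) * a₁ = 1 := by linear_combination hm - m' * hz
        have hk1 : y₁ + (k + 1) * a₁ = a₁ := by linear_combination hz
        refine ⟨k + 1, ?_, ?_⟩ <;> rw [hk1]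
        · rintro rfl
          simp at hu
        · exact ⟨m - m' * k, 0, by linear_combination hu⟩
      · exact ⟨k, hz, hk⟩
    have e₂ : s a₁ (q₀ * (y₁ + k * a₁)) = s a₁ (q₀ * y₁) :=
      hs.scaled_mod hq₀ ha₁ hay₁ ⟨k, by ring⟩
    have hay : IsCoprime a₁ (y₁ + k * a₁) := hay₁.add_mul_right_right k
    rw [← e₂] at e₁
    generalize y₁ + k * a₁ = y at *
    obtain ⟨α, β, hαβ⟩ := id hk
    have hda : q₀ * w ∣ (a * (α * y) + a₁ * (β * (q₀ * w))) - a :=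
      ⟨(a₁ - a) * β, by linear_combination a * hαβ⟩
    have hda₁ : y ∣ (a * (α * y) + a₁ * (β * (q₀ * w))) - a₁ :=
      ⟨(a - a₁) * α, by linear_combination a₁ * hαβ⟩
    generalize a * (α * y) + a₁ * (β * (q₀ * w)) = a' at *
    have ha' : q₀ ∣ a' - 1 := by
      have := dvd_add ((dvd_mul_right q₀ w).trans hda) ha
      rwa [sub_add_sub_cancel] at this
    refine ⟨a', w * y, mul_ne_zero hw hk0, ha',
      (isCoprime_of_dvd_sub haw ((dvd_mul_left w q₀).trans hda)).mul_right
        (isCoprime_of_dvd_sub hay hda₁), fun a'' ha'' x hx => ?_⟩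
    rcases Finset.mem_insert.1 hx with rfl | hx
    · have hd : q₀ * y ∣ a' - a₁ := by
        refine hk.symm.of_mul_left_left.mul_dvd ?_ hda₁
        rw [← sub_sub_sub_cancel_right a' a₁ 1]
        exact dvd_sub ha' ha₁
      have hd' : q₀ * y ∣ a'' - a₁ := by
        rw [← sub_add_sub_cancel a'' a' a₁]
        exact dvd_add ((mul_dvd_mul_left q₀ (dvd_mul_left y w)).trans ha'') hd
      refine ⟨y, isCoprime_of_dvd_sub hay ((dvd_mul_left y q₀).trans hd'), ?_⟩
      rw [e₁]
      exact hs.mod_left (q.mem_of_dvd ha₁ hq₀) (q.mul_mem_right _ hq₀)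
        ((isCoprime_of_dvd_sub_one ha₁).mul_right hay) hd'
    · refine h a'' ?_ x hx
      rw [← sub_add_sub_cancel a'' a' a]
      exact dvd_add ((mul_dvd_mul_left q₀ (dvd_mul_right w y)).trans ha'') hda

/-- For `h ≡ 1 mod q₀`, the homomorphism `y ↦ s h (q₀ * y)` from the unit group of `A / hA`. -/
noncomputable def unitsHom (hs : IsMennickeSymbol q s) {q₀ : A} (hq₀ : q₀ ∈ q) {h : A}
    (hh : q₀ ∣ h - 1) : (A ⧸ Ideal.span {h})ˣ →* Q :=
  MonoidHom.mk' (fun y => s h (q₀ * Quotient.out (y : A ⧸ Ideal.span {h}))) fun y z => by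
    have hcop := isCoprime_out_unit (h := h)
    rw [← hs.scaled_mul hq₀ hh (hcop y) (hcop z)]
    refine hs.scaled_mod hq₀ hh ((hcop y).mul_right (hcop z)) ?_
    rw [← Ideal.mem_span_singleton, ← Ideal.Quotient.eq, map_mul, Ideal.Quotient.mk_out,
      Ideal.Quotient.mk_out, Ideal.Quotient.mk_out, Units.val_mul]

theorem exists_unitsHom_eq (hs : IsMennickeSymbol q s) {q₀ : A} (hq₀ : q₀ ∈ q) {h : A}
    (hh : q₀ ∣ h - 1) {y : A} (hy : IsCoprime h y) :
    ∃ u, hs.unitsHom hq₀ hh u = s h (q₀ * y) := by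
  have hu : IsUnit (Ideal.Quotient.mk (Ideal.span {h}) y) := by
    obtain ⟨c, d, hcd⟩ := hy
    refine IsUnit.of_mul_eq_one (Ideal.Quotient.mk _ d) ?_
    rw [← map_mul, ← map_one (Ideal.Quotient.mk (Ideal.span {h})), Ideal.Quotient.eq]
    exact Ideal.mem_span_singleton'.2 ⟨-c, by linear_combination -hcd⟩
  refine ⟨hu.unit, hs.scaled_mod hq₀ hh hy ?_⟩
  rw [← Ideal.mem_span_singleton, ← Ideal.Quotient.eq, Ideal.Quotient.mk_out, IsUnit.unit_spec]

/-- A set of symbols killed by `t` has at most `t ^ r` elements if `GEN(t, r)` holds: any finite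
subset consists of symbols with the same first entry `h`, where `h` is given by `GEN(t, r)`, and
hence lies in the image of a quotient of `U / U ^ t`, where `U` is the unit group of `A / hA`. -/
theorem card_le_of_GEN [IsDomain A] (hs : IsMennickeSymbol q s) (hSR : StableRangeOneHalf A)
    {t r : ℕ} (ht : 0 < t) (hGEN : GEN t r A) {q₀ : A} (hq₀ : q₀ ∈ q) (h0 : q₀ ≠ 0)
    (hexp : ∀ a b : A, q₀ ∣ a - 1 → q₀ ∣ b → IsCoprime a b → s a b ^ t = 1) (S : Finset Q)
    (hS : ∀ x ∈ S, ∃ a b : A, a - 1 ∈ q ∧ b ∈ q ∧ IsCoprime a b ∧ s a b = x) :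
    S.card ≤ t ^ r := by
  obtain ⟨a, w, hw, ha, haw, hrep⟩ := hs.exists_common_left hSR hq₀ h0 S hS
  have hcop : Ideal.span {a, q₀ * w} = ⊤ := by
    obtain ⟨x, y, hxy⟩ := (isCoprime_of_dvd_sub_one ha).mul_right haw
    exact (Ideal.eq_top_iff_one _).2 (Ideal.mem_span_pair.2 ⟨x, y, hxy⟩)
  obtain ⟨h, hha, X, hXr, hX⟩ := hGEN a (q₀ * w) hcop
  rw [Ideal.mem_span_singleton] at hha
  have hh : q₀ ∣ h - 1 := by
    rw [← sub_add_sub_cancel h a 1]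
    exact dvd_add ((dvd_mul_right q₀ w).trans hha) ha
  have hker : (powMonoidHom t : (A ⧸ Ideal.span {h})ˣ →* _).range ≤ (hs.unitsHom hq₀ hh).ker := by
    rintro _ ⟨u, rfl⟩
    have hcop := isCoprime_out_unit u
    rw [MonoidHom.mem_ker, powMonoidHom_apply, map_pow]
    exact hexp _ _ hh (dvd_mul_right _ _) ((isCoprime_of_dvd_sub_one hh).mul_right hcop)
  let φ : UnitsModPow t (A ⧸ Ideal.span {h}) →* Q := QuotientGroup.lift _ _ hker
  obtain ⟨hfin, hcard⟩ := card_le_pow_of_closure_eq_top ht (G := UnitsModPow t (A ⧸ Ideal.span {h}))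
    (fun g => by
      obtain ⟨u, rfl⟩ := QuotientGroup.mk_surjective g
      rw [← QuotientGroup.mk_pow, QuotientGroup.eq_one_iff]
      exact ⟨u, rfl⟩) X hXr hX
  have hsub : (S : Set Q) ⊆ Set.range φ := by
    intro x hx
    obtain ⟨y, hy, rfl⟩ := hrep h hha x hx
    obtain ⟨u, hu⟩ := hs.exists_unitsHom_eq hq₀ hh hy
    exact ⟨(u : UnitsModPow t (A ⧸ Ideal.span {h})), hu⟩
  calc S.card = (S : Set Q).ncard := (Set.ncard_coe_finset S).symm
    _ ≤ (Set.range φ).ncard := Set.ncard_le_ncard hsub (Set.finite_range φ)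
    _ ≤ Nat.card (UnitsModPow t (A ⧸ Ideal.span {h})) := by
      rw [← Nat.card_coe_set_eq]
      exact Finite.card_range_le φ
    _ ≤ t ^ r := hcard

end IsMennickeSymbol

open Matrix

/-! ### Elementary matrices and row reduction -/

/-- The matrix `1 + u wᵀ` of `SL(ι, A)`, for a column `u` and a row `w` with `w u = 0`. -/
def oneAddVecMulVec {ι A : Type*} [Fintype ι] [DecidableEq ι] [CommRing A] (u w : ι → A)
    (h : w ⬝ᵥ u = 0) : Matrix.SpecialLinearGroup ι A :=
  ⟨1 + vecMulVec u w, by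
    rw [vecMulVec_eq Unit, det_one_add_replicateCol_mul_replicateRow, h, add_zero]⟩

section OneAddVecMulVec

variable {ι A : Type*} [Fintype ι] [DecidableEq ι] [CommRing A]

theorem coe_oneAddVecMulVec (u w : ι → A) (h : w ⬝ᵥ u = 0) :
    (oneAddVecMulVec u w h : Matrix ι ι A) = 1 + vecMulVec u w := rfl

theorem oneAddVecMulVec_add_left (u u' w : ι → A) (h : w ⬝ᵥ u = 0) (h' : w ⬝ᵥ u' = 0) :
    oneAddVecMulVec (u + u') w (by rw [dotProduct_add, h, h', add_zero])
      = oneAddVecMulVec u w h * oneAddVecMulVec u' w h' := by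
  refine Subtype.ext ?_
  rw [Matrix.SpecialLinearGroup.coe_mul, coe_oneAddVecMulVec, coe_oneAddVecMulVec, coe_oneAddVecMulVec,
    add_vecMulVec, mul_add, add_mul, add_mul, vecMulVec_mul_vecMulVec, h']
  simp [add_assoc]

theorem oneAddVecMulVec_add_right (u w w' : ι → A) (h : w ⬝ᵥ u = 0) (h' : w' ⬝ᵥ u = 0) :
    oneAddVecMulVec u (w + w') (by rw [add_dotProduct, h, h', add_zero])
      = oneAddVecMulVec u w h * oneAddVecMulVec u w' h' := by
  refine Subtype.ext ?_
  rw [Matrix.SpecialLinearGroup.coe_mul, coe_oneAddVecMulVec, coe_oneAddVecMulVec, coe_oneAddVecMulVec,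
    vecMulVec_add, mul_add, add_mul, add_mul, vecMulVec_mul_vecMulVec, h]
  simp [add_assoc]

theorem transvection_eq_oneAddVecMulVec {i j : ι} (hij : i ≠ j) (a b : A) :
    Matrix.SpecialLinearGroup.transvection hij (a * b)
      = oneAddVecMulVec (Pi.single i a) (Pi.single j b) (by simp [hij]) := by
  refine Subtype.ext ?_
  rw [coe_oneAddVecMulVec, Matrix.SpecialLinearGroup.transvection_coe]
  congr 1
  ext k l
  simp only [vecMulVec_apply, single_apply, Pi.single_apply]
  by_cases h1 : i = k <;> by_cases h2 : j = l <;> simp [h1, h2, eq_comm (a := k), eq_comm (a := l)]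

theorem mul_oneAddVecMulVec_mul_inv (g : Matrix.SpecialLinearGroup ι A) (u w : ι → A) (h : w ⬝ᵥ u = 0) :
    g * oneAddVecMulVec u w h * g⁻¹
      = oneAddVecMulVec ((g : Matrix ι ι A) *ᵥ u) (w ᵥ* (g⁻¹ : Matrix.SpecialLinearGroup ι A)) (by
          rw [dotProduct_mulVec, vecMul_vecMul, ← Matrix.SpecialLinearGroup.coe_mul, inv_mul_cancel,
            Matrix.SpecialLinearGroup.coe_one, vecMul_one, h]) := by
  refine Subtype.ext ?_
  rw [Matrix.SpecialLinearGroup.coe_mul, Matrix.SpecialLinearGroup.coe_mul, coe_oneAddVecMulVec,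
    coe_oneAddVecMulVec, mul_add, add_mul, mul_one, ← Matrix.SpecialLinearGroup.coe_mul, mul_inv_cancel,
    Matrix.SpecialLinearGroup.coe_one, mul_vecMulVec, vecMulVec_mul]

theorem vecMul_oneAddVecMulVec (v u w : ι → A) (h : w ⬝ᵥ u = 0) :
    v ᵥ* (oneAddVecMulVec u w h : Matrix ι ι A) = v + (v ⬝ᵥ u) • w := by
  rw [coe_oneAddVecMulVec, vecMul_add, vecMul_one, vecMul_vecMulVec]

theorem vecMul_transvection (v : ι → A) {i j : ι} (hij : i ≠ j) (a : A) :
    v ᵥ* (Matrix.SpecialLinearGroup.transvection hij a : Matrix ι ι A)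
      = v + (v i * a) • Pi.single j 1 := by
  rw [← mul_one a, transvection_eq_oneAddVecMulVec, vecMul_oneAddVecMulVec]
  simp

theorem oneAddVecMulVec_single_right_mem {H : Subgroup (Matrix.SpecialLinearGroup ι A)} {j : ι}
    {u : ι → A} (h : (Pi.single j 1 : ι → A) ⬝ᵥ u = 0)
    (hH : ∀ i (hij : i ≠ j), Matrix.SpecialLinearGroup.transvection hij (u i) ∈ H) :
    oneAddVecMulVec u (Pi.single j 1) h ∈ H := by
  have key : ∀ S : Finset ι, ∃ h, oneAddVecMulVec (∑ i ∈ S, Pi.single i (u i))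
      (Pi.single j (1 : A)) h ∈ H := by
    intro S
    induction S using Finset.induction_on with
    | empty =>
      refine ⟨by simp, ?_⟩
      convert one_mem H
      exact Subtype.ext (by simp [coe_oneAddVecMulVec])
    | insert i S hi ih =>
      obtain ⟨h1, h2⟩ := ih
      have h3 : (Pi.single j 1 : ι → A) ⬝ᵥ Pi.single i (u i) = 0 := by
        by_cases hij : i = j
        · subst hij
          simpa using h
        · simp [hij]
      have h4 : oneAddVecMulVec (Pi.single i (u i)) (Pi.single j (1 : A)) h3 ∈ H := by
        by_cases hij : i = j
        · subst hij
          convert one_mem H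
          refine Subtype.ext ?_
          simp [coe_oneAddVecMulVec, show u i = 0 by simpa using h]
        · have := hH i hij
          rwa [← mul_one (u i), transvection_eq_oneAddVecMulVec] at this
      simp only [Finset.sum_insert hi]
      refine ⟨by rw [dotProduct_add, h3, h1, add_zero], ?_⟩
      rw [oneAddVecMulVec_add_left _ _ _ h3 h1]
      exact mul_mem h4 h2
  obtain ⟨_, hS⟩ := key Finset.univ
  simpa only [Finset.univ_sum_single] using hS

theorem oneAddVecMulVec_single_left_mem {H : Subgroup (Matrix.SpecialLinearGroup ι A)} {i : ι}
    {w : ι → A} (h : w ⬝ᵥ (Pi.single i 1 : ι → A) = 0)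
    (hH : ∀ j (hij : i ≠ j), Matrix.SpecialLinearGroup.transvection hij (w j) ∈ H) :
    oneAddVecMulVec (Pi.single i 1) w h ∈ H := by
  have key : ∀ S : Finset ι, ∃ h, oneAddVecMulVec (Pi.single i (1 : A))
      (∑ j ∈ S, Pi.single j (w j)) h ∈ H := by
    intro S
    induction S using Finset.induction_on with
    | empty =>
      refine ⟨by simp, ?_⟩
      convert one_mem H
      exact Subtype.ext (by simp [coe_oneAddVecMulVec])
    | insert j S hj ih =>
      obtain ⟨h1, h2⟩ := ih
      have h3 : Pi.single j (w j) ⬝ᵥ (Pi.single i 1 : ι → A) = 0 := by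
        by_cases hij : i = j
        · subst hij
          simpa using h
        · simp [hij]
      have h4 : oneAddVecMulVec (Pi.single i (1 : A)) (Pi.single j (w j)) h3 ∈ H := by
        by_cases hij : i = j
        · subst hij
          convert one_mem H
          refine Subtype.ext ?_
          simp [coe_oneAddVecMulVec, show w i = 0 by simpa using h]
        · have := hH j hij
          rwa [← one_mul (w j), transvection_eq_oneAddVecMulVec] at this
      simp only [Finset.sum_insert hj]
      refine ⟨by rw [add_dotProduct, h3, h1, add_zero], ?_⟩
      rw [oneAddVecMulVec_add_right _ _ _ h3 h1]
      exact mul_mem h4 h2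
  obtain ⟨_, hS⟩ := key Finset.univ
  simpa only [Finset.univ_sum_single] using hS

end OneAddVecMulVec

section Elementary

variable {n : ℕ} {A : Type*} [CommRing A] {q : Ideal A}

theorem transvection_mem_Elem {i j : Fin n} (hij : i ≠ j) {a : A} (ha : a ∈ q) :
    Matrix.SpecialLinearGroup.transvection hij a ∈ Elem n q :=
  Subgroup.subset_closure ⟨i, j, hij, a, ha, rfl⟩

theorem Elem_le_ElemNormal : Elem n q ≤ ElemNormal n q :=
  (Subgroup.closure_le _).2 fun e he =>
    Subgroup.subset_closure ⟨1, one_mem _, e, he, by simp⟩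

theorem transvection_mem_ElemNormal {i j : Fin n} (hij : i ≠ j) {a : A} (ha : a ∈ q) :
    Matrix.SpecialLinearGroup.transvection hij a ∈ ElemNormal n q :=
  Elem_le_ElemNormal (transvection_mem_Elem hij ha)

theorem conj_mem_ElemNormal {e x : Matrix.SpecialLinearGroup (Fin n) A} (he : e ∈ Elem n (⊤ : Ideal A))
    (hx : x ∈ ElemNormal n q) : e * x * e⁻¹ ∈ ElemNormal n q := by
  induction hx using Subgroup.closure_induction with
  | mem x hx =>
    obtain ⟨g, hg, u, hu, rfl⟩ := hx
    exact Subgroup.subset_closure ⟨e * g, mul_mem he hg, u, hu, by group⟩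
  | one => simp
  | mul x y _ _ hx hy =>
    rw [show e * (x * y) * e⁻¹ = (e * x * e⁻¹) * (e * y * e⁻¹) by group]
    exact mul_mem hx hy
  | inv x _ hx =>
    rw [show e * x⁻¹ * e⁻¹ = (e * x * e⁻¹)⁻¹ by group]
    exact inv_mem hx

theorem ElemNormal_top_le : ElemNormal n (⊤ : Ideal A) ≤ Elem n ⊤ := by
  refine (Subgroup.closure_le _).2 ?_
  rintro _ ⟨g, hg, u, hu, rfl⟩
  exact mul_mem (mul_mem hg (Subgroup.subset_closure hu)) (inv_mem hg)

/-- The row `v` can be carried to the row `w` by an element of `E^◁(n, A; q)`. -/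
def RowEquiv (q : Ideal A) (v w : Fin n → A) : Prop :=
  ∃ z ∈ ElemNormal n q, v ᵥ* (z : Matrix (Fin n) (Fin n) A) = w

theorem RowEquiv.trans {u v w : Fin n → A} (h : RowEquiv q u v) (h' : RowEquiv q v w) :
    RowEquiv q u w := by
  obtain ⟨z, hz, rfl⟩ := h
  obtain ⟨z', hz', rfl⟩ := h'
  exact ⟨z * z', mul_mem hz hz', by rw [Matrix.SpecialLinearGroup.coe_mul, vecMul_vecMul]⟩

theorem rowEquiv_add_col (v c : Fin n → A) (j : Fin n) (hcj : c j = 0) (hc : ∀ i, c i ∈ q) :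
    RowEquiv q v (v + (v ⬝ᵥ c) • Pi.single j 1) :=
  ⟨oneAddVecMulVec c (Pi.single j 1) (by simpa using hcj),
    oneAddVecMulVec_single_right_mem _ fun i hij => transvection_mem_ElemNormal hij (hc i),
    vecMul_oneAddVecMulVec _ _ _ _⟩

theorem rowEquiv_add_row (v w : Fin n → A) (i : Fin n) (hwi : w i = 0) (hw : ∀ j, w j ∈ q) :
    RowEquiv q v (v + v i • w) :=
  ⟨oneAddVecMulVec (Pi.single i 1) w (by simpa using hwi),
    oneAddVecMulVec_single_left_mem _ fun j hij => transvection_mem_ElemNormal hij (hw j),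
    by rw [vecMul_oneAddVecMulVec]; simp⟩

/-- The row `v` is unimodular and congruent to `(1, 0, …, 0)` mod `q`. -/
def IsRelUnimodular (q : Ideal A) (v : Fin (n + 1) → A) : Prop :=
  (∀ i, v i - (Pi.single 0 1 : Fin (n + 1) → A) i ∈ q) ∧ ∃ x, v ⬝ᵥ x = 1

theorem IsRelUnimodular.of_rowEquiv {v w : Fin (n + 1) → A} (hv : IsRelUnimodular q v)
    (h : RowEquiv q v w) : IsRelUnimodular q w := by
  obtain ⟨hv, x, hx⟩ := hv
  obtain ⟨z, hz, rfl⟩ := h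
  refine ⟨fun i => ?_, ((z⁻¹ : Matrix.SpecialLinearGroup (Fin (n + 1)) A) : Matrix _ _ A) *ᵥ x, ?_⟩
  · have hz' := mem_SLq_iff.1 (ElemNormal_le_SLq _ _ hz)
    have h1 : (v ᵥ* (z : Matrix (Fin (n + 1)) (Fin (n + 1)) A)) i - v i ∈ q := by
      have h2 : (v ᵥ* (z : Matrix (Fin (n + 1)) (Fin (n + 1)) A)) i - v i
          = ∑ j, v j * ((z : Matrix (Fin (n + 1)) (Fin (n + 1)) A) j i
            - (1 : Matrix (Fin (n + 1)) (Fin (n + 1)) A) j i) := by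
        simp only [mul_sub, Finset.sum_sub_distrib]
        congr 1
        exact (congrFun (vecMul_one v) i).symm
      rw [h2]
      exact sum_mem fun j _ => q.mul_mem_left _ (hz' j i)
    have := add_mem h1 (hv i)
    rwa [sub_add_sub_cancel] at this
  · rw [dotProduct_mulVec, vecMul_vecMul, ← Matrix.SpecialLinearGroup.coe_mul, mul_inv_cancel,
      Matrix.SpecialLinearGroup.coe_one, vecMul_one, hx]

/-- A relatively unimodular row is equivalent to `(1, 0, …, 0)` if it stays unimodular when its entry
in position `1` is removed. -/
theorem rowEquiv_single_of_dotProduct {v : Fin (n + 2) → A} (hv : IsRelUnimodular q v)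
    {y : Fin (n + 2) → A} (hy1 : y 1 = 0) (hy : v ⬝ᵥ y = 1) :
    RowEquiv q v (Pi.single 0 1) := by
  have h0 : 1 - v 0 ∈ q := by simpa using neg_mem (hv.1 0)
  have h1 : v 1 ∈ q := by simpa using hv.1 1
  have e1 := rowEquiv_add_col (q := q) v ((1 - v 0 - v 1) • y) 1 (by simp [hy1])
    fun i => q.mul_mem_right _ (sub_mem h0 h1)
  rw [dotProduct_smul, hy] at e1
  refine e1.trans ?_
  have hv' := hv.of_rowEquiv e1
  have hsum : (v + ((1 - v 0 - v 1) • (1 : A)) • (Pi.single 1 1 : Fin (n + 2) → A)) 0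
      + (v + ((1 - v 0 - v 1) • (1 : A)) • (Pi.single 1 1 : Fin (n + 2) → A)) 1 = 1 := by
    simp
  generalize v + ((1 - v 0 - v 1) • (1 : A)) • (Pi.single 1 1 : Fin (n + 2) → A) = w at hv' hsum ⊢
  clear e1 hv hy h0 h1
  have h1 : w 1 ∈ q := by simpa using hv'.1 1
  have h10 : (1 : Fin (n + 2)) ≠ 0 := by simp
  -- Adding column `1` to column `0` produces an entry `1`, which clears column `1`; conjugation by
  -- that first operation keeps the product in `E^◁(n, A; q)`.
  have e2 : ∃ w', RowEquiv q w w' ∧ w' 0 = 1 := by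
    refine ⟨_, ⟨Matrix.SpecialLinearGroup.transvection h10 1
      * Matrix.SpecialLinearGroup.transvection h10.symm (-w 1)
      * (Matrix.SpecialLinearGroup.transvection h10 1)⁻¹,
      conj_mem_ElemNormal (transvection_mem_Elem _ trivial)
        (transvection_mem_ElemNormal _ (neg_mem h1)), rfl⟩, ?_⟩
    rw [Matrix.SpecialLinearGroup.transvection_inv]
    rw [Matrix.SpecialLinearGroup.coe_mul, Matrix.SpecialLinearGroup.coe_mul, ← vecMul_vecMul,
      ← vecMul_vecMul, vecMul_transvection, vecMul_transvection, vecMul_transvection]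
    simp
    linear_combination (1 + w 1) * hsum
  obtain ⟨w', e2, hw'⟩ := e2
  refine e2.trans ?_
  have hv'' := hv'.of_rowEquiv e2
  have e3 := rowEquiv_add_row (q := q) w' (Pi.single 0 1 - w') 0 (by simp [hw'])
    fun j => by simpa using neg_mem (hv''.1 j)
  rwa [hw', one_smul, add_sub_cancel] at e3

/-- If `A` is a domain with `SR_{1½}`, then every relatively unimodular row of length at least `3`
is equivalent to `(1, 0, …, 0)`. -/
theorem IsRelUnimodular.rowEquiv_single [IsDomain A] (hSR : StableRangeOneHalf A)
    {v : Fin (n + 3) → A} (hv : IsRelUnimodular q v) : RowEquiv q v (Pi.single 0 1) := by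
  -- `SR_{1½}` is applied to a quotient in which `v 0` vanishes, so `v 0` has to be made nonzero.
  obtain ⟨w, e1, hw0⟩ : ∃ w, RowEquiv q v w ∧ w 0 ≠ 0 := by
    by_cases h0 : v 0 = 0
    · have h1q : (1 : A) ∈ q := by simpa [h0] using neg_mem (hv.1 0)
      obtain ⟨j, hj⟩ : ∃ j, v j ≠ 0 := by
        by_contra! hcon
        obtain ⟨x, hx⟩ := hv.2
        rw [show v = 0 from funext hcon, zero_dotProduct] at hx
        exact zero_ne_one hx
      have hj0 : j ≠ 0 := by
        rintro rfl
        exact hj h0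
      refine ⟨_, rowEquiv_add_col v (Pi.single j 1) 0 (by simp [hj0.symm])
        fun i => (Ideal.eq_top_iff_one q).2 h1q ▸ trivial, ?_⟩
      simpa [h0] using hj
    · exact ⟨v, ⟨1, one_mem _, by simp⟩, h0⟩
  refine e1.trans ?_
  have hw := hv.of_rowEquiv e1
  clear e1 hv v
  have h1 : w 1 ∈ q := by simpa using hw.1 1
  have h12 : (1 : Fin (n + 3)) ≠ 2 := by
    change (Fin.succ 0 : Fin (n + 3)) ≠ Fin.succ (Fin.succ 0)
    exact (Fin.succ_injective _).ne (Fin.succ_ne_zero _).symm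
  let f : Fin (n + 1) → A := vecCons (w 0) fun i => w i.succ.succ.succ
  have hf0 : Ideal.span (Set.range f) ≠ ⊥ := fun h => hw0 <| by
    have : f 0 ∈ Ideal.span (Set.range f) := Ideal.subset_span ⟨0, rfl⟩
    rwa [h] at this
  obtain ⟨x, hx⟩ := hw.2
  have hsplit : ∀ v y : Fin (n + 3) → A, v ⬝ᵥ y = v 0 * y 0 + (v 1 * y 1 + (v 2 * y 2
      + ∑ i : Fin n, v i.succ.succ.succ * y i.succ.succ.succ)) := fun v y => by
    simp only [dotProduct, Fin.sum_univ_succ]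
    rfl
  have he : w 1 * x 1 + w 2 * x 2 - 1 ∈ Ideal.span (Set.range f) := by
    refine Ideal.mem_span_range_iff_exists_fun.2
      ⟨vecCons (-x 0) fun i => -x i.succ.succ.succ, ?_⟩
    rw [← hx, hsplit, Fin.sum_univ_succ]
    simp only [f, cons_val_zero, cons_val_succ, neg_mul, Finset.sum_neg_distrib, mul_comm (x _)]
    ring
  -- The square of `w 1` is used in order that the multiple of `w 1` added to `w 2` be in `q`.
  obtain ⟨t, u, htu⟩ := hSR.exists_isUnit_mod hf0 (x := w 2) (y := w 1 ^ 2)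
    ⟨2 * w 1 * x 1 * x 2 + w 2 * x 2 ^ 2, x 1 ^ 2, by
      rw [show (2 * w 1 * x 1 * x 2 + w 2 * x 2 ^ 2) * w 2 + x 1 ^ 2 * w 1 ^ 2 - 1
        = (w 1 * x 1 + w 2 * x 2 + 1) * (w 1 * x 1 + w 2 * x 2 - 1) by ring]
      exact Ideal.mul_mem_left _ _ he⟩
  obtain ⟨c, hc⟩ := Ideal.mem_span_range_iff_exists_fun.1 htu
  have e2 := rowEquiv_add_col (q := q) w (Pi.single 1 (t * w 1)) 2 (by simp [h12.symm])
    fun i => by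
      by_cases hi : i = 1
      · subst hi
        simpa using q.mul_mem_left _ h1
      · simp [hi]
  refine e2.trans (rowEquiv_single_of_dotProduct (hw.of_rowEquiv e2)
    (y := vecCons (-c 0) (vecCons 0 (vecCons u fun i => -c i.succ))) rfl ?_)
  rw [hsplit]
  rw [Fin.sum_univ_succ] at hc
  have hs2 : ∀ i : Fin n, (i.succ.succ.succ : Fin (n + 3)) ≠ 2 := fun i =>
    (Fin.succ_injective _).ne ((Fin.succ_injective _).ne (Fin.succ_ne_zero _))
  have hs0 : (0 : Fin (n + 3)) ≠ 2 := (Fin.succ_ne_zero (1 : Fin (n + 2))).symm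
  simp only [f, cons_val_zero, cons_val_succ] at hc
  simp [h12, hs2, hs0, mul_comm (w _) (c _)]
  linear_combination -hc

end Elementary

/-! ### Reduction from `SL(m + 1)` to `SL(m)` -/

section OneSum

variable {m : ℕ} {A : Type*} [CommRing A] {q : Ideal A}

theorem det_eq_of_row_zero {M : Matrix (Fin (m + 1)) (Fin (m + 1)) A} (h : M 0 = Pi.single 0 1) :
    M.det = (M.submatrix Fin.succ Fin.succ).det := by
  rw [det_succ_row_zero, Fin.sum_univ_succ]
  simp [h]

/-- The embedding `g ↦ 1 ⊕ g` of `SL(m, A)` into `SL(m + 1, A)`. -/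
def oneSum : Matrix.SpecialLinearGroup (Fin m) A →* Matrix.SpecialLinearGroup (Fin (m + 1)) A where
  toFun g := ⟨Matrix.of (vecCons (Pi.single 0 1) fun i => vecCons 0 (g i)), by
    rw [det_eq_of_row_zero rfl]
    exact g.2⟩
  map_one' := by
    ext i j
    refine Fin.cases ?_ (fun i => ?_) i <;> refine Fin.cases ?_ (fun j => ?_) j <;>
      simp [one_apply, Fin.succ_ne_zero, (Fin.succ_ne_zero _).symm]
  map_mul' g h := Subtype.ext <| by
    change Matrix.of (vecCons (Pi.single 0 1) fun i => vecCons 0 ((g * h) i))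
      = Matrix.of (vecCons (Pi.single 0 1) fun i => vecCons 0 (g i))
        * Matrix.of (vecCons (Pi.single 0 1) fun i => vecCons 0 (h i))
    ext i j
    refine Fin.cases ?_ (fun i => ?_) i <;> refine Fin.cases ?_ (fun j => ?_) j <;>
      simp [mul_apply, Fin.sum_univ_succ]

@[simp]
theorem oneSum_zero (g : Matrix.SpecialLinearGroup (Fin m) A) : oneSum g 0 = Pi.single 0 1 := rfl

@[simp]
theorem oneSum_succ_zero (g : Matrix.SpecialLinearGroup (Fin m) A) (i : Fin m) :
    oneSum g i.succ 0 = 0 := rfl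

@[simp]
theorem oneSum_succ_succ (g : Matrix.SpecialLinearGroup (Fin m) A) (i j : Fin m) :
    oneSum g i.succ j.succ = g i j := rfl

theorem oneSum_mem_SLq {g : Matrix.SpecialLinearGroup (Fin m) A} (hg : g ∈ SLq m q) :
    oneSum g ∈ SLq (m + 1) q := by
  rw [mem_SLq_iff] at hg ⊢
  intro i j
  refine Fin.cases ?_ (fun i => ?_) i <;> refine Fin.cases ?_ (fun j => ?_) j
  · simp
  · simp [(Fin.succ_ne_zero _).symm]
  · simp [Fin.succ_ne_zero]
  · simpa [one_apply] using hg i j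

theorem oneSum_transvection {i j : Fin m} (hij : i ≠ j) (a : A) :
    oneSum (Matrix.SpecialLinearGroup.transvection hij a)
      = Matrix.SpecialLinearGroup.transvection ((Fin.succ_injective m).ne hij) a := by
  ext k l
  refine Fin.cases ?_ (fun k => ?_) k <;> refine Fin.cases ?_ (fun l => ?_) l <;>
    simp [Matrix.SpecialLinearGroup.transvection_coe, one_apply, single_apply, Fin.succ_ne_zero,
      (Fin.succ_ne_zero _).symm]

theorem oneSum_mem_Elem {g : Matrix.SpecialLinearGroup (Fin m) A} (hg : g ∈ Elem m q) :
    oneSum g ∈ Elem (m + 1) q := by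
  have : Elem m q ≤ (Elem (m + 1) q).comap oneSum := by
    refine (Subgroup.closure_le _).2 ?_
    rintro _ ⟨i, j, hij, a, ha, rfl⟩
    simpa [oneSum_transvection] using transvection_mem_Elem _ ha
  exact this hg

theorem oneSum_mem_ElemNormal {g : Matrix.SpecialLinearGroup (Fin m) A}
    (hg : g ∈ ElemNormal m q) : oneSum g ∈ ElemNormal (m + 1) q := by
  have : ElemNormal m q ≤ (ElemNormal (m + 1) q).comap oneSum := by
    refine (Subgroup.closure_le _).2 ?_
    rintro _ ⟨e, he, _, ⟨i, j, hij, a, ha, rfl⟩, rfl⟩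
    refine Subgroup.mem_comap.2 ?_
    rw [map_mul, map_mul, map_inv, oneSum_transvection]
    exact conj_mem_ElemNormal (oneSum_mem_Elem he) (transvection_mem_ElemNormal _ ha)
  exact this hg

theorem isRelUnimodular_row_zero {T : Matrix.SpecialLinearGroup (Fin (m + 1)) A}
    (hT : T ∈ SLq (m + 1) q) : IsRelUnimodular q (T 0) := by
  refine ⟨fun i => ?_, fun i => T⁻¹ i 0, ?_⟩
  · simpa [one_apply, Pi.single_apply, eq_comm] using mem_SLq_iff.1 hT 0 i
  · have : (T * T⁻¹) 0 0 = 1 := by rw [mul_inv_cancel]; simp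
    rwa [Matrix.SpecialLinearGroup.coe_mul] at this

theorem exists_eq_mul_oneSum {T : Matrix.SpecialLinearGroup (Fin (m + 1)) A}
    (hT : T ∈ SLq (m + 1) q) (h0 : T 0 = Pi.single 0 1) :
    ∃ g ∈ SLq m q, ∃ x ∈ ElemNormal (m + 1) q, T = x * oneSum g := by
  have hq := mem_SLq_iff.1 hT
  let g : Matrix.SpecialLinearGroup (Fin m) A := ⟨T.1.submatrix Fin.succ Fin.succ, by
    rw [← det_eq_of_row_zero h0]
    exact T.2⟩
  have hgT : ∀ i j, g i j = T i.succ j.succ := fun _ _ => rfl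
  refine ⟨g, mem_SLq_iff.2 fun i j => ?_, oneAddVecMulVec (vecCons 0 fun i => T i.succ 0)
    (Pi.single 0 1) (by simp),
    oneAddVecMulVec_single_right_mem _ fun i hi => transvection_mem_ElemNormal _ ?_, ?_⟩
  · simpa [one_apply, hgT] using hq i.succ j.succ
  · obtain ⟨i, rfl⟩ := Fin.exists_succ_eq.2 hi
    simpa [Fin.succ_ne_zero] using hq i.succ 0
  · refine Subtype.ext ?_
    rw [Matrix.SpecialLinearGroup.coe_mul, coe_oneAddVecMulVec, add_mul, one_mul, vecMulVec_mul]
    have hrow : (Pi.single 0 1 : Fin (m + 1) → A) ᵥ* (oneSum g).1 = Pi.single 0 1 := by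
      rw [single_one_vecMul]
      rfl
    rw [hrow]
    ext i j
    rw [Matrix.add_apply, vecMulVec_apply]
    refine Fin.cases ?_ (fun i => ?_) i
    · simp [h0]
    · refine Fin.cases ?_ (fun j => ?_) j
      · simp
      · simp [hgT]

/-- If `A` is a domain with `SR_{1½}`, then `SL(m, A; q)` generates `SL(m + 1, A; q)` together with
`E^◁(m + 1, A; q)`, for `m ≥ 2`. -/
theorem exists_eq_mul_oneSum_mul [IsDomain A] (hSR : StableRangeOneHalf A)
    {T : Matrix.SpecialLinearGroup (Fin (m + 3)) A} (hT : T ∈ SLq (m + 3) q) :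
    ∃ g ∈ SLq (m + 2) q, ∃ x ∈ ElemNormal (m + 3) q, ∃ y ∈ ElemNormal (m + 3) q,
      T = x * oneSum g * y := by
  obtain ⟨z, hz, hrow⟩ := (isRelUnimodular_row_zero hT).rowEquiv_single hSR
  obtain ⟨g, hg, x, hx, h⟩ := exists_eq_mul_oneSum (mul_mem hT (ElemNormal_le_SLq _ _ hz)) hrow
  exact ⟨g, hg, x, hx, z⁻¹, inv_mem hz, by rw [← h, mul_inv_cancel_right]⟩

end OneSum

/-! ### Normality and centrality -/

section Normality

variable {m n : ℕ} {A : Type*} [CommRing A] {q : Ideal A}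

theorem transvection_eq_commutator {i j k : Fin n} (hij : i ≠ j) (hik : i ≠ k) (hkj : k ≠ j)
    (a : A) : Matrix.SpecialLinearGroup.transvection hij a
      = Matrix.SpecialLinearGroup.transvection hik a
        * (Matrix.SpecialLinearGroup.transvection hkj 1
          * (Matrix.SpecialLinearGroup.transvection hik a)⁻¹
          * (Matrix.SpecialLinearGroup.transvection hkj 1)⁻¹) := by
  rw [← mul_assoc, ← mul_assoc, eq_mul_inv_iff_mul_eq, eq_mul_inv_iff_mul_eq]
  refine Subtype.ext ?_
  simp only [Matrix.SpecialLinearGroup.coe_mul, Matrix.SpecialLinearGroup.transvection_coe, mul_add,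
    add_mul, one_mul, mul_one, single_mul_single_same, single_mul_single_of_ne _ _ _ _ hkj.symm,
    single_mul_single_of_ne _ _ _ _ hij.symm, zero_mul]
  abel

theorem oneSum_mul_transvection_mul_inv_left (g : Matrix.SpecialLinearGroup (Fin m) A)
    {i : Fin (m + 1)} (hi : i ≠ 0) (a : A) :
    ∃ h, oneSum g * Matrix.SpecialLinearGroup.transvection hi a * (oneSum g)⁻¹
      = oneAddVecMulVec ((oneSum g : Matrix (Fin (m + 1)) (Fin (m + 1)) A) *ᵥ Pi.single i a)
        (Pi.single 0 1) h := by
  have hrow : (Pi.single 0 1 : Fin (m + 1) → A) ᵥ* (oneSum g)⁻¹.1 = Pi.single 0 1 := by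
    rw [← map_inv, single_one_vecMul]
    rfl
  have key := mul_oneAddVecMulVec_mul_inv (oneSum g) (Pi.single i a) (Pi.single 0 1) (by simp [hi])
  rw [← transvection_eq_oneAddVecMulVec hi, mul_one] at key
  simp only [hrow] at key
  exact ⟨_, key⟩

theorem oneSum_mul_transvection_mul_inv_right (g : Matrix.SpecialLinearGroup (Fin m) A)
    {j : Fin (m + 1)} (hj : 0 ≠ j) (a : A) :
    ∃ h, oneSum g * Matrix.SpecialLinearGroup.transvection hj a * (oneSum g)⁻¹
      = oneAddVecMulVec (Pi.single 0 1) ((Pi.single j a : Fin (m + 1) → A) ᵥ*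
        ((oneSum g⁻¹ : Matrix.SpecialLinearGroup _ A) : Matrix (Fin (m + 1)) (Fin (m + 1)) A))
        h := by
  have hcol : (oneSum g).1 *ᵥ (Pi.single 0 1 : Fin (m + 1) → A) = Pi.single 0 1 := by
    rw [mulVec_single_one]
    ext i
    refine Fin.cases ?_ (fun i => ?_) i
    · simp
    · simp
  have key := mul_oneAddVecMulVec_mul_inv (oneSum g) (Pi.single 0 1) (Pi.single j a) (by simp [hj])
  rw [← transvection_eq_oneAddVecMulVec hj, one_mul] at key
  simp only [hcol, ← map_inv] at key
  rw [← map_inv]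
  exact ⟨_, key⟩

theorem oneSum_conj_transvection_mem (g : Matrix.SpecialLinearGroup (Fin m) A)
    {i j : Fin (m + 1)} (hij : i ≠ j) {a : A} (ha : a ∈ q) (h0 : i = 0 ∨ j = 0) :
    oneSum g * Matrix.SpecialLinearGroup.transvection hij a * (oneSum g)⁻¹ ∈ Elem (m + 1) q := by
  rcases h0 with rfl | rfl
  · obtain ⟨h, e⟩ := oneSum_mul_transvection_mul_inv_right g hij a
    rw [e]
    refine oneAddVecMulVec_single_left_mem _ fun k hk => transvection_mem_Elem _ ?_
    rw [single_vecMul]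
    exact q.mul_mem_right _ ha
  · obtain ⟨h, e⟩ := oneSum_mul_transvection_mul_inv_left g hij a
    rw [e]
    refine oneAddVecMulVec_single_right_mem _ fun k hk => transvection_mem_Elem _ ?_
    rw [mulVec_single]
    exact q.mul_mem_left _ ha

/-- Conjugation by `1 ⊕ g` takes elementary matrices in row or column `0` to products of such matrices;
the others are commutators of these, `E_{i,j}(a) = [E_{i,0}(a), E_{0,j}(1)]`. -/
theorem oneSum_conj_transvection_mem_ElemNormal (g : Matrix.SpecialLinearGroup (Fin m) A)
    {i j : Fin (m + 1)} (hij : i ≠ j) {a : A} (ha : a ∈ q) :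
    oneSum g * Matrix.SpecialLinearGroup.transvection hij a * (oneSum g)⁻¹
      ∈ ElemNormal (m + 1) q := by
  by_cases h0 : i = 0 ∨ j = 0
  · exact Elem_le_ElemNormal (oneSum_conj_transvection_mem g hij ha h0)
  · push Not at h0
    have hx := oneSum_conj_transvection_mem g h0.1 ha (Or.inr rfl)
    have hy := oneSum_conj_transvection_mem g h0.2.symm (q := ⊤) (a := 1) trivial (Or.inl rfl)
    rw [transvection_eq_commutator hij h0.1 h0.2.symm]
    have := mul_mem (Elem_le_ElemNormal hx) (conj_mem_ElemNormal hy
      (inv_mem (Elem_le_ElemNormal hx)))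
    convert this using 1
    group

theorem oneSum_conj_mem_ElemNormal (g : Matrix.SpecialLinearGroup (Fin m) A)
    {x : Matrix.SpecialLinearGroup (Fin (m + 1)) A} (hx : x ∈ ElemNormal (m + 1) q) :
    oneSum g * x * (oneSum g)⁻¹ ∈ ElemNormal (m + 1) q := by
  have hE : Elem (m + 1) (⊤ : Ideal A)
      ≤ (Elem (m + 1) ⊤).comap (MulAut.conj (oneSum g)).toMonoidHom := by
    refine (Subgroup.closure_le _).2 ?_
    rintro _ ⟨i, j, hij, a, ha, rfl⟩
    exact ElemNormal_top_le (oneSum_conj_transvection_mem_ElemNormal g hij ha)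
  have hN : ElemNormal (m + 1) q
      ≤ (ElemNormal (m + 1) q).comap (MulAut.conj (oneSum g)).toMonoidHom := by
    refine (Subgroup.closure_le _).2 ?_
    rintro _ ⟨e, he, _, ⟨i, j, hij, a, ha, rfl⟩, rfl⟩
    have := conj_mem_ElemNormal (hE he) (oneSum_conj_transvection_mem_ElemNormal g hij ha)
    rw [SetLike.mem_coe, Subgroup.mem_comap, map_mul, map_mul, map_inv]
    exact this
  exact hN hx

/-- `E^◁(n, A; q)` is normal in all of `SL(n, A)` for `n ≥ 3`, because `SL(n, A)` is generated by
`SL(n - 1, A)` and elementary matrices. -/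
theorem ElemNormal_normal [IsDomain A] (hSR : StableRangeOneHalf A) :
    (ElemNormal (m + 3) q).Normal := by
  refine ⟨fun z hz T => ?_⟩
  obtain ⟨g, -, x, hx, y, hy, rfl⟩ := exists_eq_mul_oneSum_mul (q := ⊤) hSR (T := T)
    (mem_SLq_iff.2 fun _ _ => trivial)
  have := conj_mem_ElemNormal (ElemNormal_top_le hx) (oneSum_conj_mem_ElemNormal g
    (conj_mem_ElemNormal (ElemNormal_top_le hy) hz))
  convert this using 1
  group

/-- Modulo `E^◁(m + 1, A; q)`, the block `1 ⊕ g` with `g ∈ SL(m, A; q)` commutes with all elementary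
matrices. For those in row or column `0`, conjugation by `1 ⊕ g` changes the row or column by a vector
with entries in `q`; the others are commutators of these. -/
theorem commute_mk_oneSum [(ElemNormal (m + 1) q).Normal] {g : Matrix.SpecialLinearGroup (Fin m) A}
    (hg : g ∈ SLq m q) {e : Matrix.SpecialLinearGroup (Fin (m + 1)) A} (he : e ∈ Elem (m + 1) ⊤) :
    Commute (QuotientGroup.mk' (ElemNormal (m + 1) q) (oneSum g))
      (QuotientGroup.mk' (ElemNormal (m + 1) q) e) := by
  have hmem := mem_SLq_iff.1 (oneSum_mem_SLq hg)
  have hinv := mem_SLq_iff.1 (oneSum_mem_SLq (inv_mem hg))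
  have hcomm : ∀ {e : Matrix.SpecialLinearGroup (Fin (m + 1)) A},
      (∃ x ∈ ElemNormal (m + 1) q, oneSum g * e * (oneSum g)⁻¹ = x * e) →
      Commute (QuotientGroup.mk' (ElemNormal (m + 1) q) (oneSum g))
        (QuotientGroup.mk' (ElemNormal (m + 1) q) e) := by
    rintro e ⟨x, hx, h⟩
    rw [mul_inv_eq_iff_eq_mul, mul_assoc] at h
    have hx1 : QuotientGroup.mk' (ElemNormal (m + 1) q) x = 1 := (QuotientGroup.eq_one_iff x).2 hx
    rw [commute_iff_eq, ← map_mul, ← map_mul, h, map_mul, hx1, one_mul]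
  have hleft : ∀ (i : Fin (m + 1)) (hi : i ≠ 0) (a : A),
      Commute (QuotientGroup.mk' (ElemNormal (m + 1) q) (oneSum g))
        (QuotientGroup.mk' _ (Matrix.SpecialLinearGroup.transvection hi a)) := by
    intro i hi a
    obtain ⟨h, e⟩ := oneSum_mul_transvection_mul_inv_left g hi a
    have h1 : (Pi.single 0 1 : Fin (m + 1) → A) ⬝ᵥ Pi.single i a = 0 := by simp [hi]
    have h2 : (Pi.single 0 1 : Fin (m + 1) → A) ⬝ᵥ
        ((oneSum g : Matrix (Fin (m + 1)) (Fin (m + 1)) A) *ᵥ Pi.single i a - Pi.single i a)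
        = 0 := by rw [dotProduct_sub, h, h1, sub_zero]
    refine hcomm ⟨oneAddVecMulVec _ _ h2,
      oneAddVecMulVec_single_right_mem _ fun k hk => transvection_mem_ElemNormal _ ?_, ?_⟩
    · rw [Pi.sub_apply, mulVec_single]
      convert q.mul_mem_right a (hmem k i) using 1
      simp [sub_mul, one_apply, Pi.single_apply]
    · have ht := transvection_eq_oneAddVecMulVec hi a 1
      rw [mul_one] at ht
      rw [e, ht, ← oneAddVecMulVec_add_left _ _ _ h2 h1]
      simp only [sub_add_cancel]
  have hright : ∀ (j : Fin (m + 1)) (hj : 0 ≠ j) (a : A),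
      Commute (QuotientGroup.mk' (ElemNormal (m + 1) q) (oneSum g))
        (QuotientGroup.mk' _ (Matrix.SpecialLinearGroup.transvection hj a)) := by
    intro j hj a
    obtain ⟨h, e⟩ := oneSum_mul_transvection_mul_inv_right g hj a
    have h1 : (Pi.single j a : Fin (m + 1) → A) ⬝ᵥ Pi.single 0 1 = 0 := by simp [hj]
    have h2 : ((Pi.single j a : Fin (m + 1) → A) ᵥ*
        (oneSum g⁻¹ : Matrix (Fin (m + 1)) (Fin (m + 1)) A) - Pi.single j a) ⬝ᵥ Pi.single 0 1
        = 0 := by rw [sub_dotProduct, h, h1, sub_zero]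
    refine hcomm ⟨oneAddVecMulVec _ _ h2,
      oneAddVecMulVec_single_left_mem _ fun k hk => transvection_mem_ElemNormal _ ?_, ?_⟩
    · rw [Pi.sub_apply, single_vecMul]
      convert q.mul_mem_left a (hinv j k) using 1
      simp [mul_sub, one_apply, Pi.single_apply, eq_comm]
    · have ht := transvection_eq_oneAddVecMulVec hj 1 a
      rw [one_mul] at ht
      rw [e, ht, ← oneAddVecMulVec_add_right _ _ _ h2 h1]
      simp only [sub_add_cancel]
  induction he using Subgroup.closure_induction with
  | mem e he =>
    obtain ⟨i, j, hij, a, -, rfl⟩ := he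
    by_cases hi : i = 0
    · subst hi
      exact hright j hij a
    by_cases hj : j = 0
    · subst hj
      exact hleft i hij a
    rw [transvection_eq_commutator hij hi (Ne.symm hj)]
    simp only [map_mul, map_inv]
    have hx := hleft i hi a
    have hy := hright j (Ne.symm hj) 1
    exact hx.mul_right ((hy.mul_right hx.inv_right).mul_right hy.inv_right)
  | one => simp
  | mul x y _ _ hx hy => simpa only [map_mul] using hx.mul_right hy
  | inv x _ hx => simpa only [map_inv] using hx.inv_right

end Normality

/-! ### The Mennicke symbol of `SL(3, A; q)` -/

section Three

variable {A : Type*} [CommRing A] {q : Ideal A}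

theorem mem_SLq_two {g : Matrix.SpecialLinearGroup (Fin 2) A} :
    g ∈ SLq 2 q ↔ g 0 0 - 1 ∈ q ∧ g 0 1 ∈ q ∧ g 1 0 ∈ q ∧ g 1 1 - 1 ∈ q := by
  rw [mem_SLq_iff]
  simp [Fin.forall_fin_two, and_assoc]

theorem det_two (g : Matrix.SpecialLinearGroup (Fin 2) A) :
    g 0 0 * g 1 1 - g 0 1 * g 1 0 = 1 := by
  rw [← det_fin_two]
  exact g.2

theorem exists_mem_SLq_two {a b : A} (ha : a - 1 ∈ q) (hb : b ∈ q) (hab : IsCoprime a b) :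
    ∃ g ∈ SLq 2 q, g 0 0 = a ∧ g 0 1 = b := by
  obtain ⟨x, y, hxy⟩ := hab
  -- The equation `(x * a + y * b) ^ 2 = 1` gives a second row whose first entry is in `q`.
  have hdet : a * (a * x ^ 2 + 2 * x * y * b) - b * (-(y ^ 2 * b)) = 1 := by
    linear_combination (x * a + y * b + 1) * hxy
  refine ⟨⟨!![a, b; -(y ^ 2 * b), a * x ^ 2 + 2 * x * y * b], by rw [det_fin_two_of, hdet]⟩,
    mem_SLq_two.2 ⟨ha, hb, neg_mem (q.mul_mem_left _ hb), ?_⟩, rfl, rfl⟩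
  change a * x ^ 2 + 2 * x * y * b - 1 ∈ q
  rw [show a * x ^ 2 + 2 * x * y * b - 1 = -(y ^ 2 * b) * b
    - (a * x ^ 2 + 2 * x * y * b) * (a - 1) by linear_combination hdet]
  exact sub_mem (q.mul_mem_left _ hb) (q.mul_mem_left _ ha)

/-- `SL(2, A)` in the first two coordinates of `SL(3, A)`. -/
def emb₀₁ (g : Matrix.SpecialLinearGroup (Fin 2) A) : Matrix.SpecialLinearGroup (Fin 3) A :=
  ⟨!![g 0 0, g 0 1, 0; g 1 0, g 1 1, 0; 0, 0, 1], by
    have h := det_two g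
    rw [det_fin_three]
    simpa using h⟩

/-- `SL(2, A)` in the first and the last coordinate of `SL(3, A)`. -/
def emb₀₂ (g : Matrix.SpecialLinearGroup (Fin 2) A) : Matrix.SpecialLinearGroup (Fin 3) A :=
  ⟨!![g 0 0, 0, g 0 1; 0, 1, 0; g 1 0, 0, g 1 1], by
    have h := det_two g
    rw [det_fin_three]
    simpa using h⟩

theorem coe_oneSum_two (g : Matrix.SpecialLinearGroup (Fin 2) A) :
    (oneSum g : Matrix (Fin 3) (Fin 3) A) = !![1, 0, 0; 0, g 0 0, g 0 1; 0, g 1 0, g 1 1] := by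
  ext i j
  fin_cases i <;> fin_cases j <;> rfl

theorem coe_emb₀₁ (g : Matrix.SpecialLinearGroup (Fin 2) A) :
    (emb₀₁ g : Matrix (Fin 3) (Fin 3) A) = !![g 0 0, g 0 1, 0; g 1 0, g 1 1, 0; 0, 0, 1] := rfl

theorem coe_emb₀₂ (g : Matrix.SpecialLinearGroup (Fin 2) A) :
    (emb₀₂ g : Matrix (Fin 3) (Fin 3) A) = !![g 0 0, 0, g 0 1; 0, 1, 0; g 1 0, 0, g 1 1] := rfl

/-- Elementary `3 × 3` matrices, with the indices checked by `decide`. -/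
abbrev elem₃ (i j : Fin 3) (a : A) (hij : i ≠ j := by decide) :
    Matrix.SpecialLinearGroup (Fin 3) A :=
  Matrix.SpecialLinearGroup.transvection hij a

theorem coe_elem₃ (i j : Fin 3) (a : A) (hij : i ≠ j) :
    (elem₃ i j a hij : Matrix (Fin 3) (Fin 3) A) =
      Matrix.of fun k l => (if k = l then 1 else 0) + if i = k ∧ j = l then a else 0 := by
  ext k l
  simp [Matrix.SpecialLinearGroup.transvection_coe, one_apply, single_apply]

/-- A signed permutation matrix in `E(3, A)` conjugates `1 ⊕ g` to `emb₀₂ g`. -/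
theorem semiconj_emb₀₂ (g : Matrix.SpecialLinearGroup (Fin 2) A) :
    elem₃ 0 1 1 * elem₃ 1 0 (-1) * elem₃ 0 1 1 * oneSum g
      = emb₀₂ g * (elem₃ 0 1 1 * elem₃ 1 0 (-1) * elem₃ 0 1 1) := by
  refine Subtype.ext ?_
  simp only [Matrix.SpecialLinearGroup.coe_mul, coe_elem₃, coe_oneSum_two, coe_emb₀₂]
  ext i j
  fin_cases i <;> fin_cases j <;> simp [mul_apply, Fin.sum_univ_three]

/-- A signed permutation matrix in `E(3, A)` conjugates `emb₀₂ g` to `emb₀₁ g`. -/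
theorem semiconj_emb₀₁ (g : Matrix.SpecialLinearGroup (Fin 2) A) :
    elem₃ 1 2 1 * elem₃ 2 1 (-1) * elem₃ 1 2 1 * emb₀₂ g
      = emb₀₁ g * (elem₃ 1 2 1 * elem₃ 2 1 (-1) * elem₃ 1 2 1) := by
  refine Subtype.ext ?_
  simp only [Matrix.SpecialLinearGroup.coe_mul, coe_elem₃, coe_emb₀₁, coe_emb₀₂]
  ext i j
  fin_cases i <;> fin_cases j <;> simp [mul_apply, Fin.sum_univ_three]

/-- The matrix identity behind multiplicativity of Mennicke symbols in the second entry. -/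
theorem emb₀₁_mul_oneSum {g₁ g₂ g₃ : Matrix.SpecialLinearGroup (Fin 2) A} (h : g₂ 0 0 = g₁ 0 0)
    (h00 : g₃ 0 0 = g₁ 0 0) (h01 : g₃ 0 1 = g₁ 0 1 * g₂ 0 1)
    (h10 : g₃ 1 0 = -(g₁ 1 0 * g₂ 1 0)) (h11 : g₃ 1 1 = g₂ 1 1 - g₂ 1 0 * (g₁ 1 1 * g₂ 0 1)) :
    elem₃ 2 1 (-g₂ 1 0) * (emb₀₁ g₁ * oneSum g₂) * (elem₃ 0 1 (-g₁ 0 1) * elem₃ 1 0 (-g₁ 1 0)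
      * elem₃ 1 2 (-(g₁ 1 1 * g₂ 0 1))) = emb₀₂ g₃ := by
  have hd := det_two g₁
  refine Subtype.ext ?_
  simp only [Matrix.SpecialLinearGroup.coe_mul, coe_elem₃, coe_oneSum_two, coe_emb₀₂, coe_emb₀₁]
  ext i j
  fin_cases i <;> fin_cases j <;>
    simp [mul_apply, Fin.sum_univ_three, h, h00, h01, h10, h11] <;> grind

/-- The matrix identity behind multiplicativity of Mennicke symbols in the first entry. -/
theorem emb₀₂_mul_emb₀₁ {g₁ g₂ g₃ : Matrix.SpecialLinearGroup (Fin 2) A} (h : g₂ 0 1 = g₁ 0 1)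
    (h00 : g₃ 0 0 = g₁ 0 0 * g₂ 0 0) (h01 : g₃ 0 1 = g₁ 0 1)
    (h10 : g₃ 1 0 = g₁ 1 0 * g₂ 0 0 + (g₂ 1 0 + (g₂ 1 1 - 1) * (g₁ 1 0 * g₂ 0 0)))
    (h11 : g₃ 1 1 = g₁ 1 1 + (g₂ 1 1 - 1) * g₁ 1 1) :
    elem₃ 2 1 1 * elem₃ 1 2 (g₂ 1 1 - 1) * (emb₀₂ g₁ * emb₀₁ g₂) * elem₃ 2 1 (-g₁ 0 0)
      * (elem₃ 1 0 (-(g₂ 1 0 + (g₂ 1 1 - 1) * (g₁ 1 0 * g₂ 0 0)))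
        * elem₃ 1 2 (-((g₂ 1 1 - 1) * g₁ 1 1))) = emb₀₂ g₃ := by
  have hd := det_two g₁
  refine Subtype.ext ?_
  simp only [Matrix.SpecialLinearGroup.coe_mul, coe_elem₃, coe_emb₀₂, coe_emb₀₁]
  ext i j
  fin_cases i <;> fin_cases j <;>
    simp [mul_apply, Fin.sum_univ_three, h, h00, h01, h10, h11] <;> grind

end Three

section MennickeSymbol

variable {A : Type*} [CommRing A] {q : Ideal A} [(ElemNormal 3 q).Normal]

theorem mk_eq_one {x : Matrix.SpecialLinearGroup (Fin 3) A} (hx : x ∈ ElemNormal 3 q) :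
    QuotientGroup.mk' (ElemNormal 3 q) x = 1 :=
  (QuotientGroup.eq_one_iff x).2 hx

theorem mk_elem₃_eq_one {i j : Fin 3} (hij : i ≠ j) {a : A} (ha : a ∈ q) :
    QuotientGroup.mk' (ElemNormal 3 q) (elem₃ i j a hij) = 1 :=
  mk_eq_one (transvection_mem_ElemNormal hij ha)

theorem mk_emb₀₂ {g : Matrix.SpecialLinearGroup (Fin 2) A} (hg : g ∈ SLq 2 q) :
    QuotientGroup.mk' (ElemNormal 3 q) (emb₀₂ g)
      = QuotientGroup.mk' (ElemNormal 3 q) (oneSum g) := by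
  have h := congrArg (QuotientGroup.mk' (ElemNormal 3 q)) (semiconj_emb₀₂ g)
  have hw : elem₃ 0 1 1 * elem₃ 1 0 (-1) * elem₃ 0 1 1 ∈ Elem 3 (⊤ : Ideal A) :=
    mul_mem (mul_mem (transvection_mem_Elem _ trivial) (transvection_mem_Elem _ trivial))
      (transvection_mem_Elem _ trivial)
  rw [map_mul _ _ (oneSum g), map_mul _ (emb₀₂ g), ← (commute_mk_oneSum hg hw).eq] at h
  exact (mul_right_cancel h).symm

theorem mk_emb₀₁ {g : Matrix.SpecialLinearGroup (Fin 2) A} (hg : g ∈ SLq 2 q) :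
    QuotientGroup.mk' (ElemNormal 3 q) (emb₀₁ g)
      = QuotientGroup.mk' (ElemNormal 3 q) (oneSum g) := by
  have h := congrArg (QuotientGroup.mk' (ElemNormal 3 q)) (semiconj_emb₀₁ g)
  have hw : elem₃ 1 2 1 * elem₃ 2 1 (-1) * elem₃ 1 2 1 ∈ Elem 3 (⊤ : Ideal A) :=
    mul_mem (mul_mem (transvection_mem_Elem _ trivial) (transvection_mem_Elem _ trivial))
      (transvection_mem_Elem _ trivial)
  rw [map_mul _ _ (emb₀₂ g), map_mul _ (emb₀₁ g), mk_emb₀₂ hg,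
    ← (commute_mk_oneSum hg hw).eq] at h
  exact (mul_right_cancel h).symm

/-- Modulo `E^◁(3, A; q)`, an element of `SL(2, A; q)` is determined by its first row. -/
theorem mk_oneSum_eq_of_row {g g' : Matrix.SpecialLinearGroup (Fin 2) A} (hg : g ∈ SLq 2 q)
    (hg' : g' ∈ SLq 2 q) (h0 : g' 0 0 = g 0 0) (h1 : g' 0 1 = g 0 1) :
    QuotientGroup.mk' (ElemNormal 3 q) (oneSum g')
      = QuotientGroup.mk' (ElemNormal 3 q) (oneSum g) := by
  have hd := det_two g
  have hd' := det_two g'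
  rw [h0, h1] at hd'
  have hx : g' 1 0 * g 1 1 - g' 1 1 * g 1 0 ∈ q :=
    sub_mem (q.mul_mem_right _ (mem_SLq_two.1 hg').2.2.1)
      (q.mul_mem_left _ (mem_SLq_two.1 hg).2.2.1)
  have he : g' = Matrix.SpecialLinearGroup.transvection (one_ne_zero (α := Fin 2))
      (g' 1 0 * g 1 1 - g' 1 1 * g 1 0) * g := by
    ext i j
    rw [Matrix.SpecialLinearGroup.coe_mul, Matrix.SpecialLinearGroup.transvection_coe]
    fin_cases i <;> fin_cases j <;> simp [h0, h1, add_mul]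
    · linear_combination (-g' 1 0) * hd + g 1 0 * hd'
    · linear_combination (-g' 1 1) * hd + g 1 1 * hd'
  rw [he, map_mul, map_mul, oneSum_transvection, mk_eq_one (transvection_mem_ElemNormal _ hx),
    one_mul]

variable (q) in
open Classical in
/-- The Mennicke symbol of `SL(3, A; q)`: the class modulo `E^◁(3, A; q)` of `1 ⊕ g`, for any matrix
`g ∈ SL(2, A; q)` with first row `(a, b)`. It takes the value `1` where there is no such `g`. -/
noncomputable def mennickeSymbol (a b : A) :
    Matrix.SpecialLinearGroup (Fin 3) A ⧸ ElemNormal 3 q :=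
  if h : ∃ g ∈ SLq 2 q, g 0 0 = a ∧ g 0 1 = b then
    QuotientGroup.mk' (ElemNormal 3 q) (oneSum h.choose) else 1

theorem mennickeSymbol_eq {g : Matrix.SpecialLinearGroup (Fin 2) A} (hg : g ∈ SLq 2 q) {a b : A}
    (ha : g 0 0 = a) (hb : g 0 1 = b) :
    mennickeSymbol q a b = QuotientGroup.mk' (ElemNormal 3 q) (oneSum g) := by
  have h : ∃ g ∈ SLq 2 q, g 0 0 = a ∧ g 0 1 = b := ⟨g, hg, ha, hb⟩
  rw [mennickeSymbol, dif_pos h]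
  exact mk_oneSum_eq_of_row hg h.choose_spec.1 (h.choose_spec.2.1.trans ha.symm)
    (h.choose_spec.2.2.trans hb.symm)

theorem mennickeSymbol_mul_right {a b₁ b₂ : A} (ha : a - 1 ∈ q) (hb₁ : b₁ ∈ q) (hb₂ : b₂ ∈ q)
    (h₁ : IsCoprime a b₁) (h₂ : IsCoprime a b₂) :
    mennickeSymbol q a (b₁ * b₂) = mennickeSymbol q a b₁ * mennickeSymbol q a b₂ := by
  obtain ⟨g₁, hg₁, hg₁a, rfl⟩ := exists_mem_SLq_two ha hb₁ h₁
  obtain ⟨g₂, hg₂, hg₂a, rfl⟩ := exists_mem_SLq_two ha hb₂ h₂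
  have hd₁ := det_two g₁
  have hd₂ := det_two g₂
  obtain ⟨h00, h01, h10, h11⟩ := mem_SLq_two.1 hg₁
  obtain ⟨k00, k01, k10, k11⟩ := mem_SLq_two.1 hg₂
  obtain ⟨g₃, r00, r01, r10, r11⟩ : ∃ g₃ : Matrix.SpecialLinearGroup (Fin 2) A,
      g₃ 0 0 = g₁ 0 0 ∧ g₃ 0 1 = g₁ 0 1 * g₂ 0 1 ∧ g₃ 1 0 = -(g₁ 1 0 * g₂ 1 0) ∧
        g₃ 1 1 = g₂ 1 1 - g₂ 1 0 * (g₁ 1 1 * g₂ 0 1) :=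
    ⟨⟨!![g₁ 0 0, g₁ 0 1 * g₂ 0 1; -(g₁ 1 0 * g₂ 1 0), g₂ 1 1 - g₂ 1 0 * (g₁ 1 1 * g₂ 0 1)], by
      rw [det_fin_two_of]
      rw [hg₂a, ← hg₁a] at hd₂
      linear_combination hd₂ - g₂ 0 1 * g₂ 1 0 * hd₁⟩, rfl, rfl, rfl, rfl⟩
  have hg₃ : g₃ ∈ SLq 2 q := by
    rw [mem_SLq_two, r00, r01, r10, r11, sub_right_comm]
    exact ⟨h00, q.mul_mem_left _ k01, neg_mem (q.mul_mem_left _ k10),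
      sub_mem k11 (q.mul_mem_right _ k10)⟩
  have key := congrArg (QuotientGroup.mk' (ElemNormal 3 q))
    (emb₀₁_mul_oneSum (hg₂a.trans hg₁a.symm) r00 r01 r10 r11)
  simp only [map_mul] at key
  rw [mk_elem₃_eq_one _ (neg_mem k10), mk_elem₃_eq_one _ (neg_mem h01),
    mk_elem₃_eq_one _ (neg_mem h10), mk_elem₃_eq_one _ (neg_mem (q.mul_mem_left _ k01)), one_mul,
    one_mul, mul_one, mul_one, mk_emb₀₁ hg₁, mk_emb₀₂ hg₃] at key
  rw [mennickeSymbol_eq hg₁ hg₁a rfl, mennickeSymbol_eq hg₂ hg₂a rfl,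
    mennickeSymbol_eq hg₃ (r00.trans hg₁a) r01, key]

theorem mennickeSymbol_mul_left {a₁ a₂ b : A} (ha₁ : a₁ - 1 ∈ q) (ha₂ : a₂ - 1 ∈ q) (hb : b ∈ q)
    (h₁ : IsCoprime a₁ b) (h₂ : IsCoprime a₂ b) :
    mennickeSymbol q (a₁ * a₂) b = mennickeSymbol q a₁ b * mennickeSymbol q a₂ b := by
  obtain ⟨g₁, hg₁, rfl, hg₁b⟩ := exists_mem_SLq_two ha₁ hb h₁
  obtain ⟨g₂, hg₂, rfl, hg₂b⟩ := exists_mem_SLq_two ha₂ hb h₂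
  have hd₁ := det_two g₁
  have hd₂ := det_two g₂
  obtain ⟨h00, h01, h10, h11⟩ := mem_SLq_two.1 hg₁
  obtain ⟨k00, k01, k10, k11⟩ := mem_SLq_two.1 hg₂
  have hx : g₂ 1 0 + (g₂ 1 1 - 1) * (g₁ 1 0 * g₂ 0 0) ∈ q := add_mem k10 (q.mul_mem_right _ k11)
  have hy : (g₂ 1 1 - 1) * g₁ 1 1 ∈ q := q.mul_mem_right _ k11
  obtain ⟨g₃, r00, r01, r10, r11⟩ : ∃ g₃ : Matrix.SpecialLinearGroup (Fin 2) A,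
      g₃ 0 0 = g₁ 0 0 * g₂ 0 0 ∧ g₃ 0 1 = g₁ 0 1 ∧
        g₃ 1 0 = g₁ 1 0 * g₂ 0 0 + (g₂ 1 0 + (g₂ 1 1 - 1) * (g₁ 1 0 * g₂ 0 0)) ∧
        g₃ 1 1 = g₁ 1 1 + (g₂ 1 1 - 1) * g₁ 1 1 :=
    ⟨⟨!![g₁ 0 0 * g₂ 0 0, g₁ 0 1;
        g₁ 1 0 * g₂ 0 0 + (g₂ 1 0 + (g₂ 1 1 - 1) * (g₁ 1 0 * g₂ 0 0)),
        g₁ 1 1 + (g₂ 1 1 - 1) * g₁ 1 1], by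
      rw [det_fin_two_of]
      rw [hg₂b, ← hg₁b] at hd₂
      linear_combination hd₂ + g₂ 0 0 * g₂ 1 1 * hd₁⟩, rfl, rfl, rfl, rfl⟩
  have hg₃ : g₃ ∈ SLq 2 q := by
    rw [mem_SLq_two, r00, r01, r10, r11]
    refine ⟨?_, h01, add_mem (q.mul_mem_right _ h10) hx, ?_⟩
    · rw [show g₁ 0 0 * g₂ 0 0 - 1 = (g₁ 0 0 - 1) * g₂ 0 0 + (g₂ 0 0 - 1) by ring]
      exact add_mem (q.mul_mem_right _ h00) k00
    · rw [add_sub_right_comm]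
      exact add_mem h11 hy
  have key := congrArg (QuotientGroup.mk' (ElemNormal 3 q))
    (emb₀₂_mul_emb₀₁ (hg₂b.trans hg₁b.symm) r00 r01 r10 r11)
  simp only [map_mul] at key
  rw [mk_elem₃_eq_one _ k11, mk_elem₃_eq_one _ (neg_mem hx), mk_elem₃_eq_one _ (neg_mem hy),
    mul_one, mul_one, mul_one, mk_emb₀₂ hg₁, mk_emb₀₁ hg₂, mk_emb₀₂ hg₃] at key
  -- The outer factors multiply to the class of an elementary matrix with parameter in `q`.
  have he : elem₃ (2 : Fin 3) 1 (1 : A) * elem₃ 2 1 (-g₁ 0 0) = elem₃ 2 1 (-(g₁ 0 0 - 1)) := by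
    rw [elem₃, elem₃, ← Matrix.SpecialLinearGroup.transvection_add]
    congr 1
    ring
  have hE : elem₃ (2 : Fin 3) 1 (1 : A) ∈ Elem 3 ⊤ := transvection_mem_Elem _ trivial
  have hcomm := (commute_mk_oneSum hg₁ hE).mul_left (commute_mk_oneSum hg₂ hE)
  rw [← hcomm.eq, mul_assoc, ← map_mul _ (elem₃ 2 1 1), he, mk_elem₃_eq_one _ (neg_mem h00),
    mul_one] at key
  rw [mennickeSymbol_eq hg₁ rfl hg₁b, mennickeSymbol_eq hg₂ rfl hg₂b,
    mennickeSymbol_eq hg₃ r00 (r01.trans hg₁b), key]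

theorem isMennickeSymbol_mennickeSymbol : IsMennickeSymbol q (mennickeSymbol q) where
  add_mul_right a b t ha hb hab ht := by
    obtain ⟨g, hg, rfl, rfl⟩ := exists_mem_SLq_two ha hb hab
    have hmem : Matrix.SpecialLinearGroup.transvection (zero_ne_one (α := Fin 2)) t
        ∈ ElemNormal 2 q := transvection_mem_ElemNormal _ ht
    rw [mennickeSymbol_eq (mul_mem hg (ElemNormal_le_SLq _ _ hmem)) (a := g 0 0)
      (b := g 0 1 + t * g 0 0), mennickeSymbol_eq hg rfl rfl, map_mul, map_mul,
      mk_eq_one (oneSum_mem_ElemNormal hmem), mul_one]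
    · simp [Matrix.SpecialLinearGroup.transvection_coe, mul_add]
    · simp [Matrix.SpecialLinearGroup.transvection_coe, mul_add, mul_comm, add_comm]
  add_mul_left a b t ha hb hab := by
    obtain ⟨g, hg, rfl, rfl⟩ := exists_mem_SLq_two ha hb hab
    have hmem : (Matrix.SpecialLinearGroup.transvection (one_ne_zero (α := Fin 2)) t)⁻¹
        ∈ Elem 2 (⊤ : Ideal A) := inv_mem (transvection_mem_Elem _ trivial)
    have hconj : (Matrix.SpecialLinearGroup.transvection (one_ne_zero (α := Fin 2)) t)⁻¹ * g
        * ((Matrix.SpecialLinearGroup.transvection (one_ne_zero (α := Fin 2)) t)⁻¹)⁻¹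
          ∈ SLq 2 q := (MonoidHom.normal_ker _).conj_mem g hg _
    rw [mennickeSymbol_eq hconj (a := g 0 0 + t * g 0 1) (b := g 0 1), mennickeSymbol_eq hg rfl rfl,
      map_mul, map_mul, map_mul, map_mul, ← (commute_mk_oneSum hg (oneSum_mem_Elem hmem)).eq,
      map_inv _ (_⁻¹), map_inv _ (oneSum _), mul_inv_cancel_right]
    · rw [inv_inv, Matrix.SpecialLinearGroup.transvection_inv]
      simp [Matrix.SpecialLinearGroup.transvection_coe, mul_add, add_mul, mul_comm]
    · rw [inv_inv, Matrix.SpecialLinearGroup.transvection_inv]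
      simp [Matrix.SpecialLinearGroup.transvection_coe, mul_add, add_mul]
  mul_right _ _ _ := mennickeSymbol_mul_right
  mul_left _ _ _ := mennickeSymbol_mul_left

end MennickeSymbol

/-! ### Counting cosets -/

section Count

variable {A : Type*} [CommRing A] [IsDomain A] {q : Ideal A} {t r l : ℕ}

theorem exists_mennickeSymbol_eq [(ElemNormal 3 q).Normal] (hSR : StableRangeOneHalf A)
    {T : Matrix.SpecialLinearGroup (Fin 3) A} (hT : T ∈ SLq 3 q) :
    ∃ a b : A, a - 1 ∈ q ∧ b ∈ q ∧ IsCoprime a b ∧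
      mennickeSymbol q a b = QuotientGroup.mk' (ElemNormal 3 q) T := by
  obtain ⟨g, hg, x, hx, y, hy, rfl⟩ := exists_eq_mul_oneSum_mul hSR hT
  obtain ⟨h00, h01, -, -⟩ := mem_SLq_two.1 hg
  refine ⟨g 0 0, g 0 1, h00, h01, ⟨g 1 1, -g 1 0, by linear_combination det_two g⟩, ?_⟩
  rw [mennickeSymbol_eq hg rfl rfl, map_mul, map_mul, mk_eq_one hx, mk_eq_one hy, one_mul, mul_one]

theorem exists_coset_representatives_three (hSR : StableRangeOneHalf A) (ht : 0 < t)
    (hGEN : GEN t r A) (hEXP : EXP t l A) (q : Ideal A) :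
    ∃ F : Finset (Matrix.SpecialLinearGroup (Fin 3) A), F.card ≤ t ^ r ∧ (∀ f ∈ F, f ∈ SLq 3 q) ∧
      ∀ T ∈ SLq 3 q, ∃ f ∈ F, f⁻¹ * T ∈ ElemNormal 3 q := by
  classical
  by_cases hq : q = ⊥
  · subst hq
    refine ⟨{1}, by simpa using Nat.one_le_pow _ _ ht, by simp [one_mem], fun T hT => ?_⟩
    have hT1 : T = 1 := by
      ext i j
      simpa [sub_eq_zero] using mem_SLq_iff.1 hT i j
    simp [hT1, one_mem]
  obtain ⟨q₀, hq₀, h0⟩ := Submodule.exists_mem_ne_zero_of_ne_bot hq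
  have hN : (ElemNormal 3 q).Normal := ElemNormal_normal (m := 0) hSR
  have hs := isMennickeSymbol_mennickeSymbol (q := q)
  let S := QuotientGroup.mk' (ElemNormal 3 q) '' (SLq 3 q : Set _)
  have hcard : ∀ F : Finset (Matrix.SpecialLinearGroup (Fin 3) A ⧸ ElemNormal 3 q),
      (F : Set _) ⊆ S → F.card ≤ t ^ r := fun F hF =>
    hs.card_le_of_GEN hSR ht hGEN hq₀ h0
      (fun _ _ ha hb hab => hs.pow_eq_one_of_EXP hEXP hq₀ h0 ha hb hab) F fun x hx => by
        obtain ⟨T, hT, rfl⟩ := hF hx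
        exact exists_mennickeSymbol_eq hSR hT
  have hfin : S.Finite := by
    by_contra hinf
    obtain ⟨F, hF, hc⟩ := Set.Infinite.exists_subset_card_eq hinf (t ^ r + 1)
    have := hcard F hF
    omega
  have hrep : ∀ x ∈ S, ∃ T ∈ SLq 3 q, QuotientGroup.mk' (ElemNormal 3 q) T = x := fun _ h => h
  choose! rep hrep₁ hrep₂ using hrep
  refine ⟨hfin.toFinset.image rep, Finset.card_image_le.trans (hcard _ (by simp)), ?_, ?_⟩
  · intro f hf
    obtain ⟨x, hx, rfl⟩ := Finset.mem_image.1 hf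
    exact hrep₁ x (hfin.mem_toFinset.1 hx)
  · intro T hT
    have hTS : QuotientGroup.mk' (ElemNormal 3 q) T ∈ S := ⟨T, hT, rfl⟩
    exact ⟨_, Finset.mem_image_of_mem _ (hfin.mem_toFinset.2 hTS),
      QuotientGroup.eq.1 (hrep₂ _ hTS)⟩

/-- Coset representatives for `SL(3, A; q)` serve for `SL(m + 3, A; q)` as well, embedded as the
last diagonal block. -/
theorem exists_coset_representatives (hSR : StableRangeOneHalf A) (ht : 0 < t)
    (hGEN : GEN t r A) (hEXP : EXP t l A) (q : Ideal A) (m : ℕ) :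
    ∃ F : Finset (Matrix.SpecialLinearGroup (Fin (m + 3)) A), F.card ≤ t ^ r ∧
      (∀ f ∈ F, f ∈ SLq (m + 3) q) ∧
      ∀ T ∈ SLq (m + 3) q, ∃ f ∈ F, f⁻¹ * T ∈ ElemNormal (m + 3) q := by
  classical
  induction m with
  | zero => exact exists_coset_representatives_three hSR ht hGEN hEXP q
  | succ m ih =>
    obtain ⟨F, hF, hFq, hrep⟩ := ih
    have hN : (ElemNormal (m + 1 + 3) q).Normal := ElemNormal_normal hSR
    refine ⟨F.image oneSum, Finset.card_image_le.trans hF, ?_, fun T hT => ?_⟩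
    · intro f hf
      obtain ⟨g, hg, rfl⟩ := Finset.mem_image.1 hf
      exact oneSum_mem_SLq (hFq g hg)
    · obtain ⟨g, hg, x, hx, y, hy, rfl⟩ := exists_eq_mul_oneSum_mul hSR hT
      obtain ⟨f, hf, hfg⟩ := hrep g hg
      refine ⟨oneSum f, Finset.mem_image_of_mem _ hf, ?_⟩
      have h1 : (oneSum f)⁻¹ * x * oneSum f ∈ ElemNormal (m + 1 + 3) q := by
        simpa using hN.conj_mem x hx (oneSum f)⁻¹
      have h2 := oneSum_mem_ElemNormal hfg
      rw [map_mul, map_inv] at h2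
      have := mul_mem (mul_mem h1 h2) hy
      convert this using 1
      group

end Count

end BddGen

theorem mainTheorem8 (n : ℕ) (hn : 3 ≤ n) (t r l : ℕ) (ht : 0 < t) (hr : 0 < r) (hl : 0 < l)
    (A : Type*) [CommRing A] [IsDomain A]
    (hSR : BddGen.StableRangeOneHalf A) (hGEN : BddGen.GEN t r A) (hEXP : BddGen.EXP t l A)
    (q : Ideal A) :
    BddGen.ElemNormal n q ≤ BddGen.SLq n q ∧
    ((BddGen.ElemNormal n q).subgroupOf (BddGen.SLq n q)).Normal ∧
    Finite (BddGen.SLq n q ⧸ (BddGen.ElemNormal n q).subgroupOf (BddGen.SLq n q)) ∧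
    Nat.card (BddGen.SLq n q ⧸ (BddGen.ElemNormal n q).subgroupOf (BddGen.SLq n q)) ≤ t ^ r := by
  obtain ⟨m, rfl⟩ := Nat.exists_eq_add_of_le' hn
  have hN : (BddGen.ElemNormal (m + 3) q).Normal := BddGen.ElemNormal_normal hSR
  obtain ⟨F, hF, hFq, hrep⟩ := BddGen.exists_coset_representatives hSR ht hGEN hEXP q m
  let π : F → BddGen.SLq (m + 3) q ⧸
      (BddGen.ElemNormal (m + 3) q).subgroupOf (BddGen.SLq (m + 3) q) :=
    fun f => ((⟨f, hFq f f.2⟩ : BddGen.SLq (m + 3) q) : _ ⧸ _)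
  have hπ : Function.Surjective π := by
    intro x
    obtain ⟨⟨T, hT⟩, rfl⟩ := QuotientGroup.mk_surjective x
    obtain ⟨f, hf, hfT⟩ := hrep T hT
    exact ⟨⟨f, hf⟩, QuotientGroup.eq.2 (Subgroup.mem_subgroupOf.2 hfT)⟩
  refine ⟨BddGen.ElemNormal_le_SLq _ q, hN.subgroupOf _, Finite.of_surjective π hπ, ?_⟩
  calc _ ≤ Nat.card F := Nat.card_le_card_of_surjective π hπ
    _ = F.card := by simp
    _ ≤ t ^ r := hF
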